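/- **Setting.** An automaton is $A=(Y,\Sigma,\alpha,y_0,Y_m)$ with finite state set $Y$, finite event set $\Sigma$, partial transition function $\alpha:Y\times\Sigma\to Y$ (extended to strings), initial state $y_0\in Y$ and marked states $Y_m\subseteq Y$; $\alpha(y,s)!$ means "is defined". $L(A)=\{s:\alpha(y_0,s)!\}$, $L_m(A)=\{s:\alpha(y_0,s)\in Y_m\}$. Let $G=(Q,\Sigma,\delta,q_0,Q_m)$ (plant) and $S=(X,\Sigma,\xi,x_0,X_m)$ (supervisor) be automata and $\Sigma_c\subseteq\Sigma$ the controllable events of one agent. For $x\in X$ put $E(x)=\{\sigma:\xi(x,\sigma)!\}$, $D(x)=\{\sigma\in\Sigma_{c}:\neg\xi(x,\sigma)!,\ \exists s\,(\xi(x_0,s)=x\wedge\delta(q_0,s\sigma)!)\}$, $M(x)=1$ iff $x\in X_m$, and $T(x)=1$ iff $\exists s\,(\xi(x_0,s)=x\wedge\delta(q_0,s)\in Q_m)$ (else $0$). Let $(x,x')\in\mathcal R$ iff $E(x)\cap D(x')=\emptyset=E(x')\cap D(x)$ and $T(x)=T(x')\Rightarrow M(x)=M(x')$. A *control congruence* w.r.t.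 $G,S,\Sigma_c$ is a partition $\mathcal C$ of $X$ into (nonempty) cells such that any two states of a cell are in $\mathcal R$ and, for every cell $\pi$ and event $\sigma$, all existing $\xi(x,\sigma)$ with $x\in\pi$ lie in one common cell. $[x]$ is the cell of $x$. The *local supervisor* of $\mathcal C$ is the automaton with states $\mathcal C$, events $\Sigma$, initial state $[x_0]$, marked states $\{[x]:x\in X_m\}$, and a transition $\pi_1\xrightarrow{\sigma}\pi_2$ iff $\xi(x,\sigma)\in\pi_2$ for some $x\in\pi_1$. **Input.** A base system: $G$, $S$ over the same events, pairwise disjoint sets $\Sigma_{c,k}\subseteq\Sigma$ and a control congruence $\mathcal C_k$ w.r.t. $G,S,\Sigma_{c,k}$ for each agent $1\le k\le n$. A variant system: $G'$, $S'=(X',\Sigma',\xi',x_0',X_m')$ over the same events and pairwise disjoint $\Sigma'_{c,k}\subseteq\Sigma'$ for $1\le k\le n'$, $n'\ge1$, where $S'$ is a supervisor for $G'$: if $s\in L(S')$, $s\sigma\in L(G')$ and $\sigma\notin\bigcup_k\Sigma'_{c,k}$, then $s\sigma\in L(S')$; and every state of $X'_m$ is reached in $S'$ by some string of $L_m(G')$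 (as is the case if $S'$ is accessible and $L_m(S')\subseteq L_m(G')$). A map $\mathcal M:\{1,\dots,n'\}\to\{0,\dots,n\}$. The states of $X'$ are numbered $0,\dots,|X'|-1$ in an arbitrary way. **TSL.** For each $k=1,\dots,n'$ (with $\mathcal R'$ the relation for $G',S',\Sigma'_{c,k}$, and cells taken in the current cover): 1. If $\mathcal M(k)=0$, let $\mathcal C=\{\{x\}:x\in X'\}$. Otherwise run `isolate`: start with $\mathcal C=\{\pi\cap X':\pi\in\mathcal C_{\mathcal M(k)}\}\setminus\{\emptyset\}\cup\{\{x\}:x\in X'\setminus X\}$ and repeat rounds until a round changes nothing; a round runs through all $x\in X\cap X'$, and if some $x'\in[x]$ has $(x,x')\notin\mathcal R'$ or $[\xi'(x,\sigma)]\ne[\xi'(x',\sigma)]$ for an event $\sigma$ enabled in both, it replaces the cell $[x]$ by $[x]\setminus\{x\}$ and $\{x\}$. 2. Run `localize` on $\mathcal C$: for $i=0,1,\dots$ with $x_i$ of least number in its cell, and for each $j>i$ with $x_j$ of least number in its cell, set $W=\emptyset$ and call `check_merge`$(x_i,x_j)$; if it returns true, replace $\mathcal C$ by the set of all $[x]\cup\bigcup\{[x']:(x,x')\in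 W\text{ or }(x',x)\in W\}$, $x\in X'$. Here `check_merge`$(a,b)$ runs through all pairs $(p,q)\in N(a)\times N(b)$ for which neither $(p,q)$ nor $(q,p)$ is in $W$, where $N(a)=[a]\cup\bigcup\{[x]:W\text{ contains }(x,a')\text{ or }(a',x)\text{ for some }a'\in[a]\}$ always refers to the current $W$, and returns true when none is left. For such a pair it returns false if $(p,q)\notin\mathcal R'$; otherwise it adds $(p,q)$ to $W$ and, for each event enabled in both, with successors $u,v$: nothing is done if $[u]=[v]$ or $W$ contains $(u,v)$ or $(v,u)$; it returns false if $[u]$ or $[v]$ contains a state numbered less than $i$; else it calls `check_merge`$(u,v)$ and returns false if this call does. 3. Let $\mathcal C'_k$ be the result and $LOC'_k$ its local supervisor. **Cost.** Charged are: one operation for each round of `isolate`, each iteration of a loop of TSL, `isolate` or `localize`, each isolation of a state, each call of `check_merge`, each insertion into $W$, and each common event examined for a processed pair; $1+|\Sigma'|$ for each test of a pair of states in `isolate`; $1+|\Sigma'|$ for each consistency test in `check_merge` and $|\Sigma'|$ for computing the common events of a pair; $|X'|$ for setting up the initial cover; $|X'|^2$ for each merge; $|X'|(1+|\Sigma'|)$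 for building a local supervisor. Access to $E',D',M',T'$, to cells, to their least numbers and to $W$, and the selection of the next pair that is not in $W$, are free. **Theorem.** Whatever the order in which the loops over sets are run through, TSL terminates; each $\mathcal C'_k$ is a control congruence w.r.t. $G',S',\Sigma'_{c,k}$; and the local supervisors $LOC'_1,\dots,LOC'_{n'}$ are control equivalent to $S'$ with respect to $G'$: $$L(G')\cap\bigcap_{k=1}^{n'}L(LOC'_k)=L(S')\cap L(G'),\qquad L_m(G')\cap\bigcap_{k=1}^{n'}L_m(LOC'_k)=L_m(S')\cap L_m(G').$$ If $\Sigma'\neq\emptyset$, the cost is $O(n'\cdot|\Sigma'|\cdot|X'|^4)$, with an absolute implied constant. -/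

import Mathlib

open scoped Classical

noncomputable section

namespace SupLoc

/-! ### Automata, languages and control consistency -/

/-- The data of an automaton with a partial transition function
(`trans x σ = none` means that the transition is undefined). -/
structure Automaton (St Ev : Type*) where
  states : Finset St
  events : Finset Ev
  trans : St → Ev → Option St
  init : St
  marked : Finset St

namespace Automaton

variable {St Ev : Type*}

/-- The initial and the marked states are states, and transitions lead from states to states along
events of the automaton. -/
structure Valid (A : Automaton St Ev) : Prop where
  init_mem : A.init ∈ A.states
  marked_subset : A.marked ⊆ A.states
  trans_mem : ∀ x σ y, A.trans x σ = some y → x ∈ A.states ∧ σ ∈ A.events ∧ y ∈ A.states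

/-- The state reached from the initial state by a string, if there is one. -/
def run (A : Automaton St Ev) (s : List Ev) : Option St :=
  s.foldlM A.trans A.init

/-- The language `L(A)`. -/
def lang (A : Automaton St Ev) : Set (List Ev) :=
  {s | ∃ x, A.run s = some x}

/-- The marked language `L_m(A)`. -/
def markedLang (A : Automaton St Ev) : Set (List Ev) :=
  {s | ∃ x ∈ A.marked, A.run s = some x}

/-- `E(x)`: the events enabled in `x`. -/
def enabled (A : Automaton St Ev) (x : St) : Finset Ev :=
  A.events.filter fun σ => ∃ y, A.trans x σ = some y

end Automaton

/-- A plant, a monolithic supervisor, and for each of `n` agents its set of controllable events. -/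
structure ControlledSystem (Q X Ev : Type*) (n : ℕ) where
  plant : Automaton Q Ev
  sup : Automaton X Ev
  ctrl : Fin n → Finset Ev

/-- Plant and supervisor are automata over the same events, and the sets of controllable events
of the agents are pairwise disjoint subsets of these. -/
structure ControlledSystem.Valid {Q X Ev : Type*} {n : ℕ} (P : ControlledSystem Q X Ev n) :
    Prop where
  plant_valid : P.plant.Valid
  sup_valid : P.sup.Valid
  events_eq : P.sup.events = P.plant.events
  ctrl_subset : ∀ k, P.ctrl k ⊆ P.plant.events
  ctrl_disjoint : Pairwise fun k l => Disjoint (P.ctrl k) (P.ctrl l)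

section Consistency

variable {Q X Ev : Type*} (G : Automaton Q Ev) (S : Automaton X Ev) (Sc : Finset Ev)

/-- `D(x)`: the events in `Sc` that the supervisor disables in `x` although the plant can execute
them after some string leading to `x`. -/
def disabled (x : X) : Finset Ev :=
  Sc.filter fun σ => S.trans x σ = none ∧ ∃ s, S.run s = some x ∧ s ++ [σ] ∈ G.lang

/-- `T(x) = 1`: some string leading to `x` is marked by the plant. -/
def PlantMarked (x : X) : Prop :=
  ∃ s, S.run s = some x ∧ s ∈ G.markedLang

/-- The control consistency relation of an agent with controllable events `Sc`. -/
def Consistent (x x' : X) : Prop :=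
  Disjoint (S.enabled x) (disabled G S Sc x') ∧
  Disjoint (S.enabled x') (disabled G S Sc x) ∧
  ((PlantMarked G S x ↔ PlantMarked G S x') → (x ∈ S.marked ↔ x' ∈ S.marked))

/-- Control covers. -/
structure IsControlCover (C : Finset (Finset X)) : Prop where
  cell_subset : ∀ π ∈ C, π ⊆ S.states
  covers : ∀ x ∈ S.states, ∃ π ∈ C, x ∈ π
  consistent : ∀ π ∈ C, ∀ x ∈ π, ∀ x' ∈ π, Consistent G S Sc x x'
  successor : ∀ π ∈ C, ∀ σ ∈ S.events, (∃ x ∈ π, ∃ y, S.trans x σ = some y) →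
    ∃ ρ ∈ C, ∀ x' ∈ π, ∀ y, S.trans x' σ = some y → y ∈ ρ

/-- A control congruence is a control cover that is a partition of the state set. -/
structure IsControlCongruence (C : Finset (Finset X)) : Prop extends
    IsControlCover G S Sc C where
  nonempty : ∀ π ∈ C, π.Nonempty
  disjoint : ∀ π ∈ C, ∀ ρ ∈ C, π ≠ ρ → Disjoint π ρ

end Consistency

/-- The supervisor of `P` is a supervisor for the plant of `P`: it never disables an uncontrollable
event, and each of its marked states is reached by some string that the plant marks. The latter
holds if the supervisor is accessible and `L_m(S) ⊆ L_m(G)`. -/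
structure ControlledSystem.IsSupervised {Q X Ev : Type*} {n : ℕ} (P : ControlledSystem Q X Ev n) :
    Prop where
  controllable : ∀ s σ, s ∈ P.sup.lang → s ++ [σ] ∈ P.plant.lang → (∀ k, σ ∉ P.ctrl k) →
    s ++ [σ] ∈ P.sup.lang
  marking : ∀ x ∈ P.sup.marked, PlantMarked P.plant P.sup x

/-! ### Cells and local supervisors -/

section Cells

variable {X Ev : Type*}

/-- `[x]`: the states that lie in a common cell with `x`. -/
def cell (C : Finset (Finset X)) (x : X) : Finset X :=
  (C.filter fun π => x ∈ π).biUnion id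

/-- The partition into singletons. -/
def singletonCover (S : Automaton X Ev) : Finset (Finset X) :=
  S.states.image fun x => {x}

/-- The local supervisor of a control congruence `C`: from the cell `π`, the event `σ` leads to
the cell `ρ` iff `ξ(x, σ) ∈ ρ` for some `x ∈ π`. -/
def localSupervisor (S : Automaton X Ev) (C : Finset (Finset X)) : Automaton (Finset X) Ev where
  states := C
  events := S.events
  trans π σ :=
    if h : π ∈ C ∧ ∃ ρ ∈ C, ∃ x ∈ π, ∃ y ∈ ρ, S.trans x σ = some y then some h.2.choose else none
  init := cell C S.init
  marked := S.marked.image (cell C)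

/-- For a control congruence the transition function above is the relation that defines it. -/
theorem localSupervisor_trans {Q : Type*} {G : Automaton Q Ev} {S : Automaton X Ev}
    {Sc : Finset Ev} {C : Finset (Finset X)} (hS : S.Valid) (hC : IsControlCongruence G S Sc C)
    (π ρ : Finset X) (σ : Ev) :
    (localSupervisor S C).trans π σ = some ρ ↔
      π ∈ C ∧ ρ ∈ C ∧ ∃ x ∈ π, ∃ y ∈ ρ, S.trans x σ = some y := by
  have key : ∀ ρ₁ ∈ C, ∀ ρ₂ ∈ C, π ∈ C → (∃ x ∈ π, ∃ y ∈ ρ₁, S.trans x σ = some y) →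
      (∃ x ∈ π, ∃ y ∈ ρ₂, S.trans x σ = some y) → ρ₁ = ρ₂ := by
    rintro ρ₁ h₁ ρ₂ h₂ hπ ⟨x, hx, y, hy, hxy⟩ ⟨x', hx', y', hy', hxy'⟩
    obtain ⟨τ, hτ, h⟩ := hC.successor π hπ σ (hS.trans_mem _ _ _ hxy).2.1 ⟨x, hx, y, hxy⟩
    have e₁ : ρ₁ = τ := by
      by_contra hne
      exact Finset.disjoint_left.1 (hC.disjoint _ h₁ _ hτ hne) hy (h x hx y hxy)
    have e₂ : ρ₂ = τ := by
      by_contra hne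
      exact Finset.disjoint_left.1 (hC.disjoint _ h₂ _ hτ hne) hy' (h x' hx' y' hxy')
    rw [e₁, e₂]
  simp only [localSupervisor]
  split_ifs with h
  · have hc := h.2.choose_spec
    constructor
    · intro e
      have e' := Option.some.inj e
      rw [← e']
      exact ⟨h.1, hc.1, hc.2⟩
    · rintro ⟨hπ, hρ, hx⟩
      exact congrArg some (key _ hc.1 _ hρ hπ hc.2 hx)
  · constructor
    · intro e
      cases e
    · rintro ⟨hπ, hρ, hx⟩
      exact absurd ⟨hπ, ρ, hρ, hx⟩ h

end Cells

/-- A family of local supervisors is control equivalent to `S` with respect to `G`. -/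
def ControlEquivalent {Q X Y Ev : Type*} {n : ℕ} (G : Automaton Q Ev) (S : Automaton X Ev)
    (loc : Fin n → Automaton Y Ev) : Prop :=
  G.lang ∩ (⋂ k, (loc k).lang) = S.lang ∩ G.lang ∧
  G.markedLang ∩ (⋂ k, (loc k).markedLang) = S.markedLang ∩ G.markedLang

/-! ### Algorithms

The algorithms are programs that may fail to halt and that carry a counter of the operations
executed so far. The recursion of `checkMerge` and the while-loop of `isolate` are not known to
end beforehand: they get a bound on the recursion depth, resp. on the number of rounds (`fuel`),
and give no result when it is exceeded. A program halts with a result if it gives this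
result for all sufficiently large values of `fuel`. -/

/-- Computations that may give no result and that count operations. -/
abbrev Counted (α : Type) := StateT ℕ Option α

/-- Charge `k` operations. -/
def charge (k : ℕ) : Counted Unit := modify (· + k)

/-- The program halts with this result after this number of operations. -/
def HaltsWith {α : Type} (prog : ℕ → Counted α) (result : α) (operations : ℕ) : Prop :=
  ∃ f₀, ∀ fuel, f₀ ≤ fuel → (prog fuel).run 0 = some (result, operations)

/-- The order in which a loop `for all` runs through a set of states, of events or of pairs of
states. -/
structure LoopOrder (X Ev : Type) where
  states : Finset X → List X
  states_nodup : ∀ s, (states s).Nodup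
  mem_states : ∀ s x, x ∈ states s ↔ x ∈ s
  events : Finset Ev → List Ev
  events_nodup : ∀ s, (events s).Nodup
  mem_events : ∀ s σ, σ ∈ events s ↔ σ ∈ s
  pair : Finset (X × X) → X × X
  pair_mem : ∀ s, s.Nonempty → pair s ∈ s

section Algorithms

variable {Q X Ev : Type}

/-! #### `isolate` -/

/-- Remove the states that are no longer there (a cell that becomes empty disappears) and add
the new states as singletons. -/
def isolateInit (C : Finset (Finset X)) (old new : Finset X) : Finset (Finset X) :=
  ((C.image fun π => π \ (old \ new)).erase ∅) ∪ (new \ old).image fun x => {x}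

/-- The state `x` is in conflict with a state of its cell. -/
def Conflict (G : Automaton Q Ev) (S : Automaton X Ev) (Sc : Finset Ev) (C : Finset (Finset X))
    (x : X) : Prop :=
  ∃ x' ∈ cell C x, ¬ Consistent G S Sc x x' ∨
    ∃ σ y y', S.trans x σ = some y ∧ S.trans x' σ = some y' ∧ cell C y ≠ cell C y'

/-- One round of the while-loop: the new cover, and whether some state was isolated. -/
def isolateRound (ord : LoopOrder X Ev) (G : Automaton Q Ev) (S : Automaton X Ev) (Sc : Finset Ev)
    (old : Finset X) (C : Finset (Finset X)) : Counted (Finset (Finset X) × Bool) :=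
  (ord.states (S.states ∩ old)).foldlM (fun (acc : Finset (Finset X) × Bool) x => do
    -- one consistency test and one comparison of successors per event, for each state of the cell
    charge (1 + (cell acc.1 x).card * (1 + S.events.card))
    if Conflict G S Sc acc.1 x then do
      charge 1
      pure ((acc.1 \ {cell acc.1 x}) ∪ {cell acc.1 x \ {x}} ∪ {{x}}, true)
    else
      pure acc) (C, false)

/-- The while-loop. -/
def isolateLoop (ord : LoopOrder X Ev) (G : Automaton Q Ev) (S : Automaton X Ev) (Sc : Finset Ev)
    (old : Finset X) : ℕ → Finset (Finset X) → Counted (Finset (Finset X))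
  | 0, _ => failure
  | fuel + 1, C => do
    charge 1
    let r ← isolateRound ord G S Sc old C
    if r.2 then isolateLoop ord G S Sc old fuel r.1 else pure r.1

/-- `isolate`, where `C` is a cover of the set `old` of states of the base supervisor. -/
def isolate (ord : LoopOrder X Ev) (G : Automaton Q Ev) (S : Automaton X Ev) (Sc : Finset Ev)
    (old : Finset X) (fuel : ℕ) (C : Finset (Finset X)) : Counted (Finset (Finset X)) := do
  charge S.states.card
  isolateLoop ord G S Sc old fuel (isolateInit C old S.states)

/-! #### `check_merge` -/

/-- `(x, y)` or `(y, x)` is in the waiting list `W`. -/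
def Listed (W : Finset (X × X)) (x y : X) : Prop := (x, y) ∈ W ∨ (y, x) ∈ W

/-- `[a]` together with the cells `[x]` of all `x` that `W` pairs with a state of `[a]`. -/
def near (S : Automaton X Ev) (C : Finset (Finset X)) (W : Finset (X × X)) (a : X) : Finset X :=
  cell C a ∪ (S.states.filter fun x => ∃ a' ∈ cell C a, Listed W x a').biUnion (cell C)

/-- The pairs over which the double loop of `check_merge` for `a`, `b` still has to run: those
that would be skipped, being in `W` already, are left out. -/
def pending (S : Automaton X Ev) (C : Finset (Finset X)) (W : Finset (X × X)) (a b : X) :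
    Finset (X × X) :=
  (near S C W a ×ˢ near S C W b).filter fun p => ¬ Listed W p.1 p.2

/-- `min {m | x_m ∈ [x]} < i`. -/
def HasSmaller {N : ℕ} (num : Fin N → X) (C : Finset (Finset X)) (x : X) (i : Fin N) : Prop :=
  ∃ m, m < i ∧ num m ∈ cell C x

/-- The loop of `check_merge` over the events that `p` and `q` both enable; `call` is the
recursive call. -/
def eventLoop {N : ℕ} (S : Automaton X Ev) (num : Fin N → X) (C : Finset (Finset X)) (i : Fin N)
    (call : X → X → Finset (X × X) → Counted (Bool × Finset (X × X))) (p q : X) :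
    List Ev → Finset (X × X) → Counted (Bool × Finset (X × X))
  | [], W => pure (true, W)
  | σ :: l, W =>
    match S.trans p σ, S.trans q σ with
    | some u, some v => do
      charge 1
      if cell C u = cell C v ∨ Listed W u v then
        eventLoop S num C i call p q l W
      else if HasSmaller num C u i ∨ HasSmaller num C v i then
        pure (false, W)
      else do
        charge 1
        let r ← call u v W
        if r.1 then eventLoop S num C i call p q l r.2 else pure (false, r.2)
    | _, _ => eventLoop S num C i call p q l W

/-- `check_merge`. The index sets of its double loop depend on `W` and grow with it while the loop
runs; the loop ends when no pair is pending. The last line of the `do`-block is the next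
iteration of this loop, with the same `a` and `b`. -/
def checkMerge {N : ℕ} (ord : LoopOrder X Ev) (G : Automaton Q Ev) (S : Automaton X Ev)
    (Sc : Finset Ev) (num : Fin N → X) (C : Finset (Finset X)) (i : Fin N) :
    ℕ → X → X → Finset (X × X) → Counted (Bool × Finset (X × X))
  | 0, _, _, _ => failure
  | fuel + 1, a, b, W =>
    if (pending S C W a b).Nonempty then do
      let pq := ord.pair (pending S C W a b)
      -- the consistency test
      charge (1 + S.events.card)
      if ¬ Consistent G S Sc pq.1 pq.2 then
        pure (false, W)
      else do
        -- the insertion into `W` and the computation of the common events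
        charge (1 + S.events.card)
        let r ← eventLoop S num C i (checkMerge ord G S Sc num C i fuel) pq.1 pq.2
          (ord.events (S.enabled pq.1 ∩ S.enabled pq.2)) (insert pq W)
        if r.1 then checkMerge ord G S Sc num C i fuel a b r.2 else pure (false, r.2)
    else
      pure (true, W)

/-! #### `localize` -/

/-- Merge the cells of listed pairs. -/
def mergeCells (S : Automaton X Ev) (C : Finset (Finset X)) (W : Finset (X × X)) :
    Finset (Finset X) :=
  S.states.image fun x =>
    cell C x ∪ (S.states.filter fun x' => Listed W x x').biUnion (cell C)

/-- `localize`, for states numbered by `num`. -/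
def localize {N : ℕ} (ord : LoopOrder X Ev) (G : Automaton Q Ev) (S : Automaton X Ev)
    (Sc : Finset Ev) (num : Fin N → X) (fuel : ℕ) (Cinit : Finset (Finset X)) :
    Counted (Finset (Finset X)) :=
  (List.finRange N).foldlM (fun C i => do
    charge 1
    if HasSmaller num C (num i) i then pure C
    else
      ((List.finRange N).filter fun j => i < j).foldlM (fun C j => do
        charge 1
        if HasSmaller num C (num j) j then pure C
        else do
          charge 1
          let r ← checkMerge ord G S Sc num C i fuel (num i) (num j) ∅
          if r.1 then do
            charge (S.states.card ^ 2)
            pure (mergeCells S C r.2)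
          else
            pure C) C) Cinit

/-! #### `TSL` -/

/-- `for k = 1 to n do`, collecting the results. -/
def forEach {α : Type} : (n : ℕ) → (Fin n → Counted α) → Counted (Fin n → α)
  | 0, _ => pure Fin.elim0
  | n + 1, body => do
    let a ← body 0
    let rest ← forEach n fun k => body k.succ
    pure (Fin.cons a rest)

/-- The TSL procedure for the base covers `C` of the set `old` of states of the base supervisor,
the variant system `V`, and the mapping `M` of variant agents to base agents (`none` stands for
`0`). It returns the local supervisor and the cover of each variant agent. -/
def tsl {n n' N : ℕ} (ord : LoopOrder X Ev) (num : Fin N → X) (old : Finset X)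
    (C : Fin n → Finset (Finset X)) (V : ControlledSystem Q X Ev n')
    (M : Fin n' → Option (Fin n)) (fuel : ℕ) :
    Counted (Fin n' → Automaton (Finset X) Ev × Finset (Finset X)) :=
  forEach n' fun k => do
    charge 1
    let Cinit ← match M k with
      | some j => isolate ord V.plant V.sup (V.ctrl k) old fuel (C j)
      | none => do
        charge V.sup.states.card
        pure (singletonCover V.sup)
    let Ck ← localize ord V.plant V.sup (V.ctrl k) num fuel Cinit
    -- the construction of the local supervisor
    charge (V.sup.states.card * (1 + V.sup.events.card))
    pure (localSupervisor V.sup Ck, Ck)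

end Algorithms

end SupLoc

end

/-!
A run of `check_merge` keeps the following invariant: while the calls for certain pairs of states
are open, the relation of lying in a common cell or being linked by a pair in `W` becomes an
equivalence relation once every element linked to one component of an open pair is also linked to
every element linked to the other. Mergers commute, so a call made during another one may be
regarded as the outermost and completed first. When the outermost call returns true, no pair is
open; the relation is then an equivalence relation whose classes are the merged cells, and these
form a control congruence since every pair in `W` has passed the consistency test and has had its
common events examined. Each pair is inserted into `W` at most once and pays a fixed price of order
`|Σ'|` for all work that it causes, so that a call costs `O(|Σ'| |X'| ^ 2)`.

Every isolation creates a new state that is alone in its cell, so `isolate` ends after at most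
`|X'| + 1` rounds, and the round without change certifies the control congruence.

The local supervisors of control congruences simulate `S'`. Conversely, let a string of `L(S')` be
extended by a controllable event that the plant and the local supervisor of its agent allow. The
event is then enabled at some state of the cell reached, hence by consistency not disabled at the
state reached, so `S'` allows it. Marking is treated in the same way with `T'` and `M'`.
-/

namespace SupLoc

/-! ### Counted programs -/

/-- Total correctness of a program: whatever the counter shows at the start, with enough fuel the
program ends with some result `r` after some number `k` of further operations, and `P r k`
holds. -/
def Ensures {α : Type} (prog : ℕ → Counted α) (P : α → ℕ → Prop) : Prop :=
  ∀ s, ∃ r k, (∀ᶠ fuel in Filter.atTop, (prog fuel).run s = some (r, s + k)) ∧ P r k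

namespace Ensures

variable {α β : Type}

theorem exists_haltsWith {prog : ℕ → Counted α} {P : α → ℕ → Prop} (h : Ensures prog P) :
    ∃ r k, HaltsWith prog r k ∧ P r k := by
  obtain ⟨r, k, hrun, hP⟩ := h 0
  exact ⟨r, k, by simpa [HaltsWith] using hrun, hP⟩

theorem mono {prog : ℕ → Counted α} {P P' : α → ℕ → Prop} (h : Ensures prog P)
    (hP : ∀ r k, P r k → P' r k) : Ensures prog P' := fun s =>
  let ⟨r, k, hrun, hr⟩ := h s
  ⟨r, k, hrun, hP r k hr⟩

theorem pure {a : α} {P : α → ℕ → Prop} (h : P a 0) :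
    Ensures (fun _ => (Pure.pure a : Counted α)) P :=
  fun _ => ⟨a, 0, .of_forall fun _ => rfl, h⟩

theorem bind {m : ℕ → Counted α} {g : ℕ → α → Counted β} {P : α → ℕ → Prop} {P' : β → ℕ → Prop}
    (hm : Ensures m P)
    (hg : ∀ r k, P r k → Ensures (fun f => g f r) fun r' k' => P' r' (k + k')) :
    Ensures (fun f => m f >>= g f) P' := fun s => by
  obtain ⟨r, k, hrun, hr⟩ := hm s
  obtain ⟨r', k', hrun', hr'⟩ := hg r k hr (s + k)
  refine ⟨r', k + k', ?_, hr'⟩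
  filter_upwards [hrun, hrun'] with f h h'
  rw [StateT.run_bind, h, ← add_assoc]
  exact h'

theorem charge {c : ℕ} {g : ℕ → Counted β} {P : β → ℕ → Prop}
    (hg : Ensures g fun r k => P r (c + k)) :
    Ensures (fun f => SupLoc.charge c >>= fun _ => g f) P :=
  bind (P := fun _ k => k = c) (fun _ => ⟨(), c, .of_forall fun _ => rfl, rfl⟩)
    fun _ _ h => h ▸ hg

theorem of_succ {prog : ℕ → Counted α} {P : α → ℕ → Prop}
    (h : Ensures (fun f => prog (f + 1)) P) : Ensures prog P := fun s => by
  obtain ⟨r, k, hrun, hr⟩ := h s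
  refine ⟨r, k, ?_, hr⟩
  rwa [← Filter.map_add_atTop_eq_nat 1, Filter.eventually_map]

/-- `Inv l b` is the invariant of the accumulator `b` when the elements of `l` are still to be
processed. -/
theorem foldlM {step : ℕ → β → α → Counted β} {Inv : List α → β → Prop} {c : ℕ}
    (hstep : ∀ a l b, Inv (a :: l) b →
      Ensures (fun f => step f b a) fun r k => Inv l r ∧ k ≤ c) :
    ∀ l b, Inv l b →
      Ensures (fun f => l.foldlM (step f) b) fun r k => Inv [] r ∧ k ≤ l.length * c
  | [], b, hb => by
    simpa only [List.foldlM_nil] using pure ⟨hb, Nat.zero_le _⟩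
  | a :: l, b, hb => by
    simp only [List.foldlM_cons]
    refine bind (hstep a l b hb) fun r k ⟨hr, hk⟩ => ?_
    refine (foldlM hstep l r hr).mono fun r' k' ⟨hr', hk'⟩ => ⟨hr', ?_⟩
    rw [List.length_cons, Nat.succ_mul]
    omega

theorem forEach {c : ℕ} : ∀ (n : ℕ) {body : ℕ → Fin n → Counted α} {P : Fin n → α → Prop},
    (∀ k, Ensures (fun f => body f k) fun r c' => P k r ∧ c' ≤ c) →
    Ensures (fun f => SupLoc.forEach n (body f)) fun r c' => (∀ k, P k (r k)) ∧ c' ≤ n * c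
  | 0, _, _, _ => pure ⟨fun k => k.elim0, Nat.zero_le _⟩
  | n + 1, _, _, h => by
    refine bind (h 0) fun r k ⟨hr, hk⟩ => ?_
    refine bind (forEach n fun k => h k.succ) fun r' k' ⟨hr', hk'⟩ => ?_
    refine pure ⟨Fin.cases hr hr', ?_⟩
    rw [Nat.succ_mul]
    omega

end Ensures

/-! ### Partitions and control congruences -/

section Partitions

variable {Q X Ev : Type*}

theorem mem_cell {C : Finset (Finset X)} {x y : X} : y ∈ cell C x ↔ ∃ π ∈ C, x ∈ π ∧ y ∈ π := by
  simp [cell, and_assoc]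

theorem cell_parts {s : Finset X} (P : Finpartition s) (x : X) : cell P.parts x = P.part x := by
  ext y
  rw [mem_cell, P.mem_part_iff_exists]
  simp only [and_comm]

theorem part_eq_part_of_mem {s : Finset X} (P : Finpartition s) {x y : X} (h : y ∈ P.part x) :
    P.part y = P.part x :=
  P.part_eq_of_mem (P.part_mem.2 (P.part_nonempty.1 ⟨y, h⟩)) h

theorem mem_part_iff {s : Finset X} (P : Finpartition s) {x y : X} (hy : y ∈ s) :
    y ∈ P.part x ↔ P.part y = P.part x :=
  ⟨part_eq_part_of_mem P, fun h => h ▸ P.mem_part hy⟩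

variable {G : Automaton Q Ev} {S : Automaton X Ev} {Sc : Finset Ev}

theorem consistent_self (x : X) : Consistent G S Sc x x := by
  have h : Disjoint (S.enabled x) (disabled G S Sc x) := by
    simp only [Automaton.enabled, disabled]
    refine Finset.disjoint_filter_filter' _ _ (Pi.disjoint_iff.2 fun σ => ?_)
    rw [Prop.disjoint_iff]
    rintro ⟨⟨y, hy⟩, hn, -⟩
    simp [hn] at hy
  exact ⟨h, h, fun _ => Iff.rfl⟩

theorem Consistent.symm {x y : X} (h : Consistent G S Sc x y) : Consistent G S Sc y x :=
  ⟨h.2.1, h.1, fun e => (h.2.2 e.symm).symm⟩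

/-- The cells of a control congruence, as a Mathlib partition of the state set. -/
def IsControlCongruence.finpartition {C : Finset (Finset X)} (hC : IsControlCongruence G S Sc C) :
    Finpartition S.states where
  parts := C
  supIndep := Finset.supIndep_iff_pairwiseDisjoint.2 fun π hπ ρ hρ => hC.disjoint π hπ ρ hρ
  sup_parts := by
    ext x
    rw [Finset.mem_sup]
    exact ⟨fun ⟨π, hπ, hx⟩ => hC.cell_subset π hπ hx, hC.covers x⟩
  bot_notMem h := Finset.not_nonempty_empty (hC.nonempty _ h)

theorem IsControlCongruence.cell_eq_part {C : Finset (Finset X)}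
    (hC : IsControlCongruence G S Sc C) (x : X) : cell C x = hC.finpartition.part x :=
  cell_parts hC.finpartition x

theorem isControlCongruence_parts_iff (hS : S.Valid) {P : Finpartition S.states} :
    IsControlCongruence G S Sc P.parts ↔ ∀ x, ∀ x' ∈ P.part x, Consistent G S Sc x x' ∧
      ∀ σ y y', S.trans x σ = some y → S.trans x' σ = some y' → P.part y = P.part y' where
  mp h x x' hx' := by
    have hx := P.part_nonempty.1 ⟨x', hx'⟩
    refine ⟨h.consistent _ (P.part_mem.2 hx) x (P.mem_part hx) x' hx', fun σ y y' hy hy' => ?_⟩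
    obtain ⟨ρ, hρ, hsucc⟩ := h.successor _ (P.part_mem.2 hx) σ (hS.trans_mem _ _ _ hy).2.1
      ⟨x, P.mem_part hx, y, hy⟩
    rw [P.part_eq_of_mem hρ (hsucc x (P.mem_part hx) y hy),
      P.part_eq_of_mem hρ (hsucc x' hx' y' hy')]
  mpr h :=
    { cell_subset := fun _ => P.subset
      covers := fun _ hx => ⟨_, P.part_mem.2 hx, P.mem_part hx⟩
      consistent := fun π hπ x hx x' hx' => (h x x' (by rwa [P.part_eq_of_mem hπ hx])).1
      successor := by
        rintro π hπ σ - ⟨x, hx, y, hy⟩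
        refine ⟨P.part y, P.part_mem.2 (hS.trans_mem _ _ _ hy).2.2, fun x' hx' y' hy' => ?_⟩
        rw [(h x x' (by rwa [P.part_eq_of_mem hπ hx])).2 σ y y' hy hy']
        exact P.mem_part (hS.trans_mem _ _ _ hy').2.2
      nonempty := fun _ => P.nonempty_of_mem_parts
      disjoint := fun _ hπ _ hρ => P.disjoint hπ hρ }

end Partitions

/-! ### Completion of pending mergers -/

section Join

variable {X : Type*} {H H' : X → X → Prop}

/-- `z` is related to a component of the pair `p`. -/
def Touches (H : X → X → Prop) (p : X × X) (z : X) : Prop := H p.1 z ∨ H p.2 z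

/-- The relation `H` after the merger of the pair `p`: the elements related to a component of `p`
become pairwise related. -/
def join (H : X → X → Prop) (p : X × X) (x y : X) : Prop :=
  H x y ∨ Touches H p x ∧ Touches H p y

theorem touches_join_iff {p q : X × X} {z : X} : Touches (join H p) q z ↔
    Touches H q z ∨ (Touches H p q.1 ∨ Touches H p q.2) ∧ Touches H p z := by
  simp only [Touches, join]
  tauto

theorem join_comm [Std.Symm H] (p q : X × X) : join (join H p) q = join (join H q) p := by
  have meet_comm : (Touches H p q.1 ∨ Touches H p q.2) ↔ Touches H q p.1 ∨ Touches H q p.2 := by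
    simp only [Touches, comm_of H (a := q.1), comm_of H (a := q.2)]
    tauto
  have unfold_join : ∀ (p q : X × X) (x y : X), join (join H p) q x y ↔
      (H x y ∨ Touches H p x ∧ Touches H p y) ∨
        (Touches H q x ∨ (Touches H p q.1 ∨ Touches H p q.2) ∧ Touches H p x) ∧
          (Touches H q y ∨ (Touches H p q.1 ∨ Touches H p q.2) ∧ Touches H p y) := by
    intro p q x y
    rw [join, touches_join_iff, touches_join_iff, join]
  ext x y
  rw [unfold_join, unfold_join, meet_comm]
  tauto

instance [Std.Symm H] (p : X × X) : Std.Symm (join H p) where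
  symm _ _ := Or.imp symm And.symm

instance [Std.Symm H] [IsTrans X H] (p : X × X) : IsTrans X (join H p) where
  trans x y z := by
    have extend : ∀ {x y}, H x y → Touches H p x → Touches H p y := fun h =>
      Or.imp (_root_.trans · h) (_root_.trans · h)
    rintro (hxy | ⟨hx, hy⟩) (hyz | ⟨hy', hz⟩)
    · exact Or.inl (_root_.trans hxy hyz)
    · exact Or.inr ⟨extend (symm hxy) hy', hz⟩
    · exact Or.inr ⟨hx, extend hyz hy⟩
    · exact Or.inr ⟨hx, hz⟩

theorem join_eq_of_le_of_le_join {p : X × X} (h : ∀ x y, H x y → H' x y)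
    (h' : ∀ x y, H' x y → join H p x y) : join H' p = join H p := by
  have touches_iff : ∀ z, Touches H' p z ↔ Touches H p z := fun z =>
    ⟨Or.rec (fun hz => (h' _ _ hz).elim Or.inl And.right)
      fun hz => (h' _ _ hz).elim Or.inr And.right, Or.imp (h _ _) (h _ _)⟩
  ext x y
  rw [join, touches_iff, touches_iff]
  exact ⟨Or.rec (h' x y) Or.inr, Or.imp_left (h x y)⟩

/-- The relation `H` after the mergers of the pairs in `L`, the head of `L` first. -/
def joinAll (L : List (X × X)) (H : X → X → Prop) : X → X → Prop := L.foldl join H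

theorem joinAll_join (p : X × X) : ∀ (L : List (X × X)) (H : X → X → Prop) [Std.Symm H],
    joinAll L (join H p) = join (joinAll L H) p
  | [], _, _ => rfl
  | q :: L, H, _ => by
    change joinAll L (join (join H p) q) = join (joinAll L (join H q)) p
    rw [join_comm, joinAll_join p L]

theorem joinAll_symm : ∀ (L : List (X × X)) (H : X → X → Prop) [Std.Symm H],
    Std.Symm (joinAll L H)
  | [], _, h => h
  | p :: L, H, _ => joinAll_symm L (join H p)

end Join

/-! ### Waiting lists -/

section WaitingLists

variable {X : Type} {s : Finset X} {P : Finpartition s} {W W' : Finset (X × X)}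

theorem Listed.symm {x y : X} (h : Listed W x y) : Listed W y x := Or.symm h

theorem Listed.mono {x y : X} (h : Listed W x y) (hW : W ⊆ W') : Listed W' x y :=
  Or.imp (@hW _) (@hW _) h

/-- The cells of `x` and `y` coincide or `W` lists a pair of states from these cells. -/
def Linked (P : Finpartition s) (W : Finset (X × X)) (x y : X) : Prop :=
  P.part x = P.part y ∨ ∃ x' ∈ P.part x, ∃ y' ∈ P.part y, Listed W x' y'

instance : Std.Symm (Linked P W) where
  symm _ _ := Or.imp Eq.symm fun ⟨x', hx, y', hy, h⟩ => ⟨y', hy, x', hx, h.symm⟩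

instance : IsTrans X (Linked P ∅) where
  trans x y z := by
    simp only [Linked, Listed, Finset.notMem_empty, or_self, and_false, exists_false, or_false]
    exact Eq.trans

theorem linked_self (x : X) : Linked P W x x := Or.inl rfl

theorem Linked.mono {x y : X} (h : Linked P W x y) (hW : W ⊆ W') : Linked P W' x y :=
  h.imp_right fun ⟨x', hx, y', hy, h⟩ => ⟨x', hx, y', hy, h.mono hW⟩

theorem Linked.of_mem_part {x y z : X} (h : Linked P W x y) (hy : y ∈ P.part z) :
    Linked P W x z := by
  rwa [Linked, ← part_eq_part_of_mem P hy]

theorem Linked.of_mem_part_of_mem {x y z : X} (h : Linked P W x y) (hz : z ∈ P.part y) :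
    Linked P W x z := by
  rwa [Linked, part_eq_part_of_mem P hz]

theorem Linked.mem {x y : X} (h : Linked P W x y) (hx : x ∈ s) : y ∈ s := by
  rcases h with e | ⟨-, -, y', hy, -⟩
  · exact P.part_nonempty.1 (e ▸ P.part_nonempty.2 hx)
  · exact P.part_nonempty.1 ⟨y', hy⟩

theorem linked_of_listed {x y : X} (hx : x ∈ s) (hy : y ∈ s) (h : Listed W x y) :
    Linked P W x y :=
  Or.inr ⟨x, P.mem_part hx, y, P.mem_part hy, h⟩

theorem mem_near_iff {Ev : Type} {S : Automaton X Ev} {P : Finpartition S.states} {a y : X}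
    (ha : a ∈ S.states) : y ∈ near S P.parts W a ↔ Linked P W a y := by
  simp only [near, cell_parts, Finset.mem_union, Finset.mem_biUnion, Finset.mem_filter]
  constructor
  · rintro (hy | ⟨x, ⟨hx, a', ha', hxa⟩, hy⟩)
    · exact (linked_self a).of_mem_part_of_mem hy
    · exact Linked.of_mem_part_of_mem (Or.inr ⟨a', ha', x, P.mem_part hx, hxa.symm⟩) hy
  · intro h
    have hy := h.mem ha
    rcases h with e | ⟨x', hx', y', hy', h⟩
    · exact Or.inl ((mem_part_iff P hy).2 e.symm)
    · refine Or.inr ⟨y', ⟨P.part_subset y hy', x', hx', h.symm⟩, ?_⟩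
      rw [part_eq_part_of_mem P hy']
      exact P.mem_part hy

theorem join_linked_insert {a b p q : X} (hp : Linked P W a p) (hq : Linked P W b q) :
    join (Linked P (insert (p, q) W)) (a, b) = join (Linked P W) (a, b) := by
  refine join_eq_of_le_of_le_join (fun x y h => h.mono (Finset.subset_insert _ _)) ?_
  rintro x y (e | ⟨x', hx, y', hy, h | h⟩)
  · exact Or.inl (Or.inl e)
  · rcases Finset.mem_insert.1 h with e | h
    · obtain ⟨rfl, rfl⟩ := Prod.mk.inj e
      exact Or.inr ⟨Or.inl (hp.of_mem_part hx), Or.inr (hq.of_mem_part hy)⟩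
    · exact Or.inl (Or.inr ⟨x', hx, y', hy, Or.inl h⟩)
  · rcases Finset.mem_insert.1 h with e | h
    · obtain ⟨rfl, rfl⟩ := Prod.mk.inj e
      exact Or.inr ⟨Or.inr (hq.of_mem_part hx), Or.inl (hp.of_mem_part hy)⟩
    · exact Or.inl (Or.inr ⟨x', hx, y', hy, Or.inr h⟩)

/-- `W` lists every pair of a state linked to `a` and a state linked to `b`: the double loop of
`check_merge` for `a` and `b` has nothing left to do. -/
def Saturated (P : Finpartition s) (W : Finset (X × X)) (a b : X) : Prop :=
  ∀ x y, Linked P W a x → Linked P W b y → Listed W x y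

theorem Saturated.listed {a b : X} (h : Saturated P W a b) : Listed W a b :=
  h a b (linked_self a) (linked_self b)

theorem saturated_of_pending_eq_empty {Ev : Type} {S : Automaton X Ev}
    {P : Finpartition S.states} {a b : X} (ha : a ∈ S.states) (hb : b ∈ S.states)
    (h : pending S P.parts W a b = ∅) : Saturated P W a b := fun x y hx hy => by
  by_contra hn
  refine Finset.notMem_empty (x, y) (h ▸ Finset.mem_filter.2 ⟨?_, hn⟩)
  exact Finset.mk_mem_product ((mem_near_iff ha).2 hx) ((mem_near_iff hb).2 hy)

theorem Saturated.join_linked_eq {a b : X} (h : Saturated P W a b) (ha : a ∈ s) (hb : b ∈ s) :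
    join (Linked P W) (a, b) = Linked P W := by
  have of_left : ∀ x, Linked P W a x → Linked P W b x := fun x hx =>
    linked_of_listed hb (hx.mem ha) (h x b hx (linked_self b)).symm
  have of_right : ∀ x, Linked P W b x → Linked P W a x := fun x hx =>
    linked_of_listed ha (hx.mem hb) (h a x (linked_self a) hx)
  ext x y
  refine ⟨?_, Or.inl⟩
  rintro (hl | ⟨hx, hy⟩)
  · exact hl
  · have hx := hx.elim id (of_right x)
    have hy := hy.elim (of_left y) id
    exact linked_of_listed (hx.mem ha) (hy.mem hb) (h x y hx hy)

/-- The invariant of `check_merge` when the calls for the pairs in `L` are open, the innermost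
first: `W` is a list of pairs of states, and completing the open calls would make the linked states
an equivalence relation. -/
structure Admissible (P : Finpartition s) (L : List (X × X)) (W : Finset (X × X)) : Prop where
  subset : W ⊆ s ×ˢ s
  trans : IsTrans X (joinAll L (Linked P W))

namespace Admissible

variable {L : List (X × X)}

theorem empty : Admissible P [] ∅ where
  subset := Finset.empty_subset _
  trans := inferInstanceAs (IsTrans X (Linked P ∅))

theorem card_le (h : Admissible P L W) : W.card ≤ s.card ^ 2 := by
  rw [sq, ← Finset.card_product]
  exact Finset.card_le_card h.subset

-- Mergers commute, so the new innermost call may be regarded as the outermost one.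
theorem cons (h : Admissible P L W) (p : X × X) : Admissible P (p :: L) W where
  subset := h.subset
  trans := by
    have := h.trans
    have := joinAll_symm L (Linked P W)
    change IsTrans X (joinAll L (join (Linked P W) p))
    rw [joinAll_join]
    infer_instance

theorem tail {a b : X} (h : Admissible P ((a, b) :: L) W) (hab : Saturated P W a b) (ha : a ∈ s)
    (hb : b ∈ s) : Admissible P L W where
  subset := h.subset
  trans := by
    have := h.trans
    rwa [joinAll, List.foldl_cons, hab.join_linked_eq ha hb] at this

theorem insert {a b p q : X} (h : Admissible P ((a, b) :: L) W) (ha : a ∈ s) (hb : b ∈ s)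
    (hp : Linked P W a p) (hq : Linked P W b q) :
    Admissible P ((a, b) :: L) (insert (p, q) W) where
  subset := Finset.insert_subset (Finset.mk_mem_product (hp.mem ha) (hq.mem hb)) h.subset
  trans := by
    have := h.trans
    rwa [joinAll, List.foldl_cons, ← join_linked_insert hp hq] at this

end Admissible

end WaitingLists

/-! ### `check_merge` -/

section Settled

variable {Q X Ev : Type} {G : Automaton Q Ev} {S : Automaton X Ev} {Sc : Finset Ev}
  {P : Finpartition S.states} {W W' : Finset (X × X)}

/-- The successors of the components of `p` under `σ`, if both exist, lie in a common cell or are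
listed. -/
def SuccessorsIdentified (S : Automaton X Ev) (P : Finpartition S.states) (W : Finset (X × X))
    (p : X × X) (σ : Ev) : Prop :=
  ∀ u v, S.trans p.1 σ = some u → S.trans p.2 σ = some v → P.part u = P.part v ∨ Listed W u v

theorem SuccessorsIdentified.of_trans_eq_some {p : X × X} {σ : Ev} {u v : X}
    (hu : S.trans p.1 σ = some u) (hv : S.trans p.2 σ = some v)
    (h : P.part u = P.part v ∨ Listed W u v) : SuccessorsIdentified S P W p σ := by
  intro u' v' hu' hv'
  cases hu.symm.trans hu'
  cases hv.symm.trans hv'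
  exact h

theorem SuccessorsIdentified.mono {p : X × X} {σ : Ev} (h : SuccessorsIdentified S P W p σ)
    (hW : W ⊆ W') : SuccessorsIdentified S P W' p σ := fun u v hu hv =>
  (h u v hu hv).imp_right fun huv => huv.mono hW

/-- All that has to be checked and listed on account of the pair `p` has been. -/
structure Settled (G : Automaton Q Ev) (S : Automaton X Ev) (Sc : Finset Ev)
    (P : Finpartition S.states) (W : Finset (X × X)) (p : X × X) : Prop where
  consistent : Consistent G S Sc p.1 p.2
  listed : ∀ x ∈ P.part p.1, ∀ y ∈ P.part p.2, Listed W x y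
  successor : ∀ σ, SuccessorsIdentified S P W p σ

theorem Settled.mono {p : X × X} (h : Settled G S Sc P W p) (hW : W ⊆ W') :
    Settled G S Sc P W' p where
  consistent := h.consistent
  listed x hx y hy := (h.listed x hx y hy).mono hW
  successor σ := (h.successor σ).mono hW

/-- `W'` arises from `W` by adding pairs that are settled in `W'`. -/
structure Extends (G : Automaton Q Ev) (S : Automaton X Ev) (Sc : Finset Ev)
    (P : Finpartition S.states) (W W' : Finset (X × X)) : Prop where
  subset : W ⊆ W'
  settled : ∀ p ∈ W', p ∉ W → Settled G S Sc P W' p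

namespace Extends

theorem refl (W : Finset (X × X)) : Extends G S Sc P W W :=
  ⟨subset_rfl, fun _ h h' => absurd h h'⟩

theorem trans {W'' : Finset (X × X)} (h : Extends G S Sc P W W') (h' : Extends G S Sc P W' W'') :
    Extends G S Sc P W W'' where
  subset := h.subset.trans h'.subset
  settled p hp hn :=
    if hp' : p ∈ W' then (h.settled p hp' hn).mono h'.subset else h'.settled p hp hp'

theorem of_insert {p : X × X} (h : Extends G S Sc P (insert p W) W')
    (hp : Settled G S Sc P W' p) : Extends G S Sc P W W' where
  subset := (Finset.subset_insert _ _).trans h.subset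
  settled q hq hn := by
    by_cases e : q = p
    · rwa [e]
    · exact h.settled q hq (by simp [e, hn])

end Extends

/-- What holds when `check_merge` or its loop over the events, started on `W` while the calls for
the pairs in `L` are open, ends with `r` after `k` operations; `Φ` is an additional property of the
waiting list in case of success. Each insertion pays for `4 * |Σ| + 2` operations, and `c` bounds
those that no insertion pays for, apart from a failing consistency test. -/
structure Outcome (G : Automaton Q Ev) (S : Automaton X Ev) (Sc : Finset Ev)
    (P : Finpartition S.states) (L : List (X × X)) (W : Finset (X × X)) (c : ℕ)
    (Φ : Finset (X × X) → Prop) (r : Bool × Finset (X × X)) (k : ℕ) : Prop where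
  subset : W ⊆ r.2
  states : r.2 ⊆ S.states ×ˢ S.states
  cost : k + (4 * S.events.card + 2) * W.card ≤
    (4 * S.events.card + 2) * r.2.card + c + if r.1 then 0 else 1 + S.events.card
  success : r.1 = true →
    Extends G S Sc P W r.2 ∧ IsTrans X (joinAll L (Linked P r.2)) ∧ Φ r.2

namespace Outcome

variable {L : List (X × X)} {c c' k : ℕ} {Φ Φ' : Finset (X × X) → Prop}
  {r : Bool × Finset (X × X)}

theorem done (hW : Admissible P L W) (hΦ : Φ W) : Outcome G S Sc P L W 0 Φ (true, W) 0 where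
  subset := subset_rfl
  states := hW.subset
  cost := by simp
  success _ := ⟨.refl W, hW.trans, hΦ⟩

theorem fail (hW : W ⊆ S.states ×ˢ S.states) (hk : k ≤ c + (1 + S.events.card)) :
    Outcome G S Sc P L W c Φ (false, W) k where
  subset := subset_rfl
  states := hW
  cost := by
    simp only [Bool.false_eq_true, if_false]
    omega
  success := by simp

theorem mono (h : Outcome G S Sc P L W c Φ r k) (hc : c ≤ c')
    (hΦ : ∀ W', W ⊆ W' → Φ W' → Φ' W') : Outcome G S Sc P L W c' Φ' r k where
  subset := h.subset
  states := h.states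
  cost := by have := h.cost; omega
  success hr := (h.success hr).imp_right (.imp_right (hΦ _ h.subset))

theorem charge (h : Outcome G S Sc P L W c Φ r k) (j : ℕ) :
    Outcome G S Sc P L W (j + c) Φ r (j + k) where
  __ := h
  cost := by have := h.cost; omega

theorem of_insert {p : X × X} (h : Outcome G S Sc P L (insert p W) c Φ r k) (hp : p ∉ W)
    (hc : c ≤ 4 * S.events.card + 2)
    (hΦ : ∀ W', insert p W ⊆ W' → Φ W' → Settled G S Sc P W' p ∧ Φ' W') :
    Outcome G S Sc P L W 0 Φ' r k where
  subset := (Finset.subset_insert _ _).trans h.subset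
  states := h.states
  cost := by
    have := h.cost
    rw [Finset.card_insert_of_notMem hp, mul_add_one] at this
    omega
  success hr :=
    let ⟨hext, htrans, hpost⟩ := h.success hr
    let ⟨hsettled, hpost'⟩ := hΦ _ h.subset hpost
    ⟨hext.of_insert hsettled, htrans, hpost'⟩

theorem le_of_empty (h : Outcome G S Sc P L ∅ 0 Φ r k) :
    k ≤ (4 * S.events.card + 2) * S.states.card ^ 2 + (1 + S.events.card) := by
  have hcard := Finset.card_le_card h.states
  rw [Finset.card_product, ← sq] at hcard
  have hmul := Nat.mul_le_mul_left (4 * S.events.card + 2) hcard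
  have := h.cost
  rw [Finset.card_empty] at this
  split_ifs at this <;> omega

end Outcome

theorem Ensures.outcome_seq {m : ℕ → Counted (Bool × Finset (X × X))}
    {g : ℕ → Finset (X × X) → Counted (Bool × Finset (X × X))} {L₁ L₂ : List (X × X)} {c₁ c₂ : ℕ}
    {Φ₁ Φ₂ : Finset (X × X) → Prop} (hm : Ensures m (Outcome G S Sc P L₁ W c₁ Φ₁))
    (hg : ∀ W', Admissible P L₁ W' → W ⊆ W' → Φ₁ W' →
      Ensures (fun f => g f W') (Outcome G S Sc P L₂ W' c₂ Φ₂)) :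
    Ensures (fun f => m f >>= fun r => if r.1 then g f r.2 else Pure.pure (false, r.2))
      (Outcome G S Sc P L₂ W (c₁ + c₂) Φ₂) := by
  refine bind hm fun r k hr => ?_
  rcases r with ⟨_ | _, W'⟩
  · refine pure ⟨hr.subset, hr.states, ?_, fun h => absurd h Bool.false_ne_true⟩
    have := hr.cost
    simp only [Bool.false_eq_true, if_false] at this ⊢
    omega
  · obtain ⟨hext, htrans, hΦ⟩ := hr.success rfl
    refine (hg W' ⟨hr.states, htrans⟩ hr.subset hΦ).mono fun r' k' hr' => ?_
    refine ⟨hr.subset.trans hr'.subset, hr'.states, ?_, fun h => ?_⟩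
    · have h₁ := hr.cost
      have h₂ := hr'.cost
      simp only [if_true] at h₁
      omega
    · exact ⟨hext.trans (hr'.success h).1, (hr'.success h).2⟩

end Settled

section CheckMerge

variable {Q X Ev : Type} {G : Automaton Q Ev} {S : Automaton X Ev} {Sc : Finset Ev}
  {P : Finpartition S.states} {N d : ℕ} {num : Fin N → X} {i : Fin N}

/-- The program `call` meets the specification of `check_merge` whenever the waiting list has at
least `d` entries. -/
def CorrectFrom (G : Automaton Q Ev) (S : Automaton X Ev) (Sc : Finset Ev)
    (P : Finpartition S.states) (d : ℕ)
    (call : ℕ → X → X → Finset (X × X) → Counted (Bool × Finset (X × X))) : Prop :=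
  ∀ (L : List (X × X)) (a b : X) (W : Finset (X × X)), a ∈ S.states → b ∈ S.states →
    Admissible P ((a, b) :: L) W → d ≤ W.card →
    Ensures (fun f => call f a b W) (Outcome G S Sc P L W 0 fun W' => Saturated P W' a b)

theorem eventLoop_ensures (hS : S.Valid) {L : List (X × X)} {p q : X}
    {call : ℕ → X → X → Finset (X × X) → Counted (Bool × Finset (X × X))}
    (hcall : CorrectFrom G S Sc P d call) :
    ∀ (l : List Ev) (W : Finset (X × X)), Admissible P L W → d ≤ W.card →
      Ensures (fun f => eventLoop S num P.parts i (call f) p q l W)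
        (Outcome G S Sc P L W (2 * l.length) fun W' =>
          ∀ σ ∈ l, SuccessorsIdentified S P W' (p, q) σ)
  | [], W, hW, _ => by
    simp only [eventLoop]
    exact .pure (.done hW (by simp))
  | σ :: l, W, hW, hd => by
    have rest : ∀ W', Admissible P L W' → W ⊆ W' → SuccessorsIdentified S P W' (p, q) σ →
        Ensures (fun f => eventLoop S num P.parts i (call f) p q l W')
          (Outcome G S Sc P L W' (2 * l.length) fun W'' =>
            ∀ τ ∈ σ :: l, SuccessorsIdentified S P W'' (p, q) τ) := fun W' hW' hsub hσ =>
      (eventLoop_ensures hS hcall l W' hW' (hd.trans (Finset.card_le_card hsub))).mono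
        fun r k hr => hr.mono le_rfl fun W'' hsub' hl =>
          List.forall_mem_cons.2 ⟨hσ.mono hsub', hl⟩
    simp only [List.length_cons]
    rcases hu : S.trans p σ with _ | u
    · simp only [eventLoop, hu]
      exact (rest W hW subset_rfl fun u v hu' => by simp [hu] at hu').mono
        fun r k hr => hr.mono (by omega) fun _ _ => id
    rcases hv : S.trans q σ with _ | v
    · simp only [eventLoop, hu, hv]
      exact (rest W hW subset_rfl fun u v _ hv' => by simp [hv] at hv').mono
        fun r k hr => hr.mono (by omega) fun _ _ => id
    simp only [eventLoop, hu, hv, cell_parts]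
    refine .charge ?_
    split_ifs with huv hsmaller
    · exact (rest W hW subset_rfl (.of_trans_eq_some hu hv huv)).mono
        fun r k hr => (hr.charge 1).mono (by omega) fun _ _ => id
    · exact .pure (.fail hW.subset (by omega))
    · have hcall_uv := hcall L u v W (hS.trans_mem _ _ _ hu).2.2 (hS.trans_mem _ _ _ hv).2.2
        (hW.cons (u, v)) hd
      refine .charge ((hcall_uv.outcome_seq fun W' hW' hsub hsat =>
        rest W' hW' hsub (.of_trans_eq_some hu hv (Or.inr hsat.listed))).mono fun r k hr => ?_)
      exact ((hr.charge 1).charge 1).mono (by omega) fun _ _ => id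

theorem length_events_le (ord : LoopOrder X Ev) {s : Finset Ev} (hs : s ⊆ S.events) :
    (ord.events s).length ≤ S.events.card := by
  rw [← List.toFinset_card_of_nodup (ord.events_nodup s)]
  exact Finset.card_le_card fun σ hσ => hs ((ord.mem_events s σ).1 (List.mem_toFinset.1 hσ))

theorem eventLoop_seq_ensures (hS : S.Valid) (ord : LoopOrder X Ev) {L : List (X × X)}
    {W : Finset (X × X)} {a b p q : X}
    {call : ℕ → X → X → Finset (X × X) → Counted (Bool × Finset (X × X))}
    (hcall : CorrectFrom G S Sc P (W.card + 1) call) (ha : a ∈ S.states) (hb : b ∈ S.states)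
    (hW : Admissible P ((a, b) :: L) W) (hp : Linked P W a p) (hq : Linked P W b q)
    (hnew : (p, q) ∉ W) (hc : Consistent G S Sc p q) :
    Ensures (fun f => do
        let r ← eventLoop S num P.parts i (call f) p q
          (ord.events (S.enabled p ∩ S.enabled q)) (insert (p, q) W)
        if r.1 then call f a b r.2 else pure (false, r.2))
      fun r k => Outcome G S Sc P L W 0 (fun W' => Saturated P W' a b) r
        ((1 + S.events.card) + ((1 + S.events.card) + k)) := by
  have hcard : (insert (p, q) W).card = W.card + 1 := Finset.card_insert_of_notMem hnew
  have hlen := length_events_le (S := S) ord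
    (Finset.inter_subset_left.trans (Finset.filter_subset _ _) :
      S.enabled p ∩ S.enabled q ⊆ S.events)
  have hloop := eventLoop_ensures (num := num) (i := i) hS (p := p) (q := q) hcall
    (ord.events (S.enabled p ∩ S.enabled q)) _ (hW.insert ha hb hp hq) hcard.ge
  have hnext : ∀ W', Admissible P ((a, b) :: L) W' → insert (p, q) W ⊆ W' →
      (∀ σ ∈ ord.events (S.enabled p ∩ S.enabled q), SuccessorsIdentified S P W' (p, q) σ) →
      Ensures (fun f => call f a b W') (Outcome G S Sc P L W' 0 fun W'' =>
        Saturated P W'' a b ∧ ∀ σ, SuccessorsIdentified S P W'' (p, q) σ) := by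
    intro W' hW' hsub hsucc
    refine (hcall L a b W' ha hb hW' (hcard.ge.trans (Finset.card_le_card hsub))).mono
      fun r k hr => hr.mono le_rfl fun W'' hsub' hsat => ⟨hsat, fun σ u v hu hv => ?_⟩
    have hσ := (hS.trans_mem _ _ _ hu).2.1
    refine (hsucc σ ?_).mono hsub' u v hu hv
    rw [ord.mem_events, Finset.mem_inter]
    exact ⟨Finset.mem_filter.2 ⟨hσ, u, hu⟩, Finset.mem_filter.2 ⟨hσ, v, hv⟩⟩
  refine (hloop.outcome_seq hnext).mono fun r k hr => ?_
  refine ((hr.charge (1 + S.events.card)).charge (1 + S.events.card)).of_insert hnew (by omega)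
    fun W' hsub ⟨hsat, hsucc⟩ => ⟨⟨hc, fun x hx y hy => hsat x y ?_ ?_, hsucc⟩, hsat⟩
  · exact (hp.mono ((Finset.subset_insert _ _).trans hsub)).of_mem_part_of_mem hx
  · exact (hq.mono ((Finset.subset_insert _ _).trans hsub)).of_mem_part_of_mem hy

theorem CorrectFrom.checkMerge_of_succ (hS : S.Valid) (ord : LoopOrder X Ev)
    (h : CorrectFrom G S Sc P (d + 1) (checkMerge ord G S Sc num P.parts i)) :
    CorrectFrom G S Sc P d (checkMerge ord G S Sc num P.parts i) := by
  intro L a b W ha hb hW hd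
  refine .of_succ ?_
  by_cases hpending : (pending S P.parts W a b).Nonempty
  · simp only [checkMerge, if_pos hpending]
    have hmem := ord.pair_mem _ hpending
    generalize ord.pair (pending S P.parts W a b) = pq at hmem ⊢
    obtain ⟨p, q⟩ := pq
    obtain ⟨hpq, hnew⟩ := Finset.mem_filter.1 hmem
    obtain ⟨hp, hq⟩ := Finset.mem_product.1 hpq
    rw [mem_near_iff ha] at hp
    rw [mem_near_iff hb] at hq
    refine .charge ?_
    by_cases hc : Consistent G S Sc p q
    · simp only [hc, not_true, if_false]
      exact .charge (eventLoop_seq_ensures hS ord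
        (fun L' u v W' hu hv hW' hd' => h L' u v W' hu hv hW' (by omega)) ha hb hW hp hq
        (fun hpq => hnew (Or.inl hpq)) hc)
    · simp only [hc, not_false_eq_true, if_true]
      exact .pure (.fail hW.subset (by omega))
  · simp only [checkMerge, if_neg hpending]
    have hsat := saturated_of_pending_eq_empty ha hb (Finset.not_nonempty_iff_eq_empty.1 hpending)
    exact .pure (.done (hW.tail hsat ha hb) hsat)

-- A waiting list is a set of pairs of states, which bounds the depth of the recursion.
theorem checkMerge_correctFrom_zero (hS : S.Valid) (ord : LoopOrder X Ev) :
    CorrectFrom G S Sc P 0 (checkMerge ord G S Sc num P.parts i) := by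
  refine Nat.decreasingInduction (n := S.states.card ^ 2 + 1)
    (motive := fun d _ => CorrectFrom G S Sc P d (checkMerge ord G S Sc num P.parts i))
    (fun _ _ h => h.checkMerge_of_succ hS ord) ?_ (Nat.zero_le _)
  intro L a b W _ _ hW hd
  have := hW.card_le
  omega

end CheckMerge

/-! ### `localize` -/

section Localize

variable {Q X Ev : Type} {G : Automaton Q Ev} {S : Automaton X Ev} {Sc : Finset Ev}
  {P : Finpartition S.states} {W : Finset (X × X)}

theorem Extends.part_eq_or_listed (h : Extends G S Sc P ∅ W) {x y : X} (hx : x ∈ S.states)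
    (hy : y ∈ S.states) (hl : Linked P W x y) : P.part x = P.part y ∨ Listed W x y := by
  rcases hl with e | ⟨x', hx', y', hy', hl⟩
  · exact Or.inl e
  · have hx'' : x ∈ P.part x' := (mem_part_iff P hx).2 (part_eq_part_of_mem P hx').symm
    have hy'' : y ∈ P.part y' := (mem_part_iff P hy).2 (part_eq_part_of_mem P hy').symm
    rcases hl with hl | hl
    · exact Or.inr ((h.settled _ hl (Finset.notMem_empty _)).listed x hx'' y hy'')
    · exact Or.inr ((h.settled _ hl (Finset.notMem_empty _)).listed y hy'' x hx'').symm

/-- The equivalence relation whose classes are the merged cells. -/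
def linkedSetoid (P : Finpartition S.states) (W : Finset (X × X)) [IsTrans X (Linked P W)] :
    Setoid X where
  r := Linked P W
  iseqv := ⟨linked_self, symm, _root_.trans⟩

theorem mergeCells_eq_parts [IsTrans X (Linked P W)] (h : Extends G S Sc P ∅ W) :
    mergeCells S P.parts W = (Finpartition.ofSetSetoid (linkedSetoid P W) S.states).parts := by
  refine Finset.image_congr fun x hx => ?_
  have hx : x ∈ S.states := hx
  ext y
  simp only [cell_parts, Finset.mem_union, Finset.mem_biUnion, Finset.mem_filter]
  constructor
  · rintro (hy | ⟨x', ⟨hx', hl⟩, hy⟩)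
    · exact ⟨P.part_subset x hy, (linked_self x).of_mem_part_of_mem hy⟩
    · exact ⟨P.part_subset x' hy, (linked_of_listed hx hx' hl).of_mem_part_of_mem hy⟩
  · rintro ⟨hy, hl⟩
    rcases h.part_eq_or_listed hx hy hl with e | hl
    · exact Or.inl ((mem_part_iff P hy).2 e.symm)
    · exact Or.inr ⟨y, ⟨hy, hl⟩, P.mem_part hy⟩

theorem mergeCells_isControlCongruence (hS : S.Valid) (hP : IsControlCongruence G S Sc P.parts)
    [IsTrans X (Linked P W)] (h : Extends G S Sc P ∅ W) :
    IsControlCongruence G S Sc (mergeCells S P.parts W) := by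
  rw [isControlCongruence_parts_iff hS] at hP
  rw [mergeCells_eq_parts h, isControlCongruence_parts_iff hS]
  have part_eq : ∀ {σ x x' y y'}, S.trans x σ = some y → S.trans x' σ = some y' →
      (P.part y = P.part y' ∨ Listed W y y') →
      (Finpartition.ofSetSetoid (linkedSetoid P W) S.states).part y =
        (Finpartition.ofSetSetoid (linkedSetoid P W) S.states).part y' := by
    intro σ x x' y y' hy hy' hyy'
    have hys := (hS.trans_mem _ _ _ hy).2.2
    have hys' := (hS.trans_mem _ _ _ hy').2.2
    refine (part_eq_part_of_mem _ (Finpartition.mem_part_ofSetSetoid_iff_rel _ |>.2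
      ⟨hys, hys', ?_⟩)).symm
    exact hyy'.elim Or.inl (linked_of_listed hys hys')
  intro x x' hx'
  obtain ⟨hx, hx', hl⟩ := (Finpartition.mem_part_ofSetSetoid_iff_rel _).1 hx'
  rcases h.part_eq_or_listed hx hx' hl with e | hl | hl
  · have hxx' := hP x x' ((mem_part_iff P hx').2 e.symm)
    exact ⟨hxx'.1, fun σ y y' hy hy' => part_eq hy hy' (Or.inl (hxx'.2 σ y y' hy hy'))⟩
  · have hp := h.settled _ hl (Finset.notMem_empty _)
    exact ⟨hp.consistent, fun σ y y' hy hy' => part_eq hy hy' (hp.successor σ y y' hy hy')⟩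
  · have hp := h.settled _ hl (Finset.notMem_empty _)
    exact ⟨hp.consistent.symm,
      fun σ y y' hy hy' => (part_eq hy' hy (hp.successor σ y' y hy' hy)).symm⟩

variable {C : Finset (Finset X)} {N : ℕ} {num : Fin N → X} {i : Fin N}

theorem checkMerge_ensures (hS : S.Valid) (hC : IsControlCongruence G S Sc C)
    (ord : LoopOrder X Ev) {a b : X} (ha : a ∈ S.states) (hb : b ∈ S.states) :
    Ensures (fun f => checkMerge ord G S Sc num C i f a b ∅) fun r k =>
      (r.1 = true → IsControlCongruence G S Sc (mergeCells S C r.2)) ∧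
        k ≤ (4 * S.events.card + 2) * S.states.card ^ 2 + (1 + S.events.card) := by
  refine (checkMerge_correctFrom_zero (P := hC.finpartition) hS ord [] a b ∅ ha hb
    (Admissible.empty.cons (a, b)) (Nat.zero_le _)).mono fun r k hr => ⟨fun h => ?_, hr.le_of_empty⟩
  obtain ⟨hext, htrans, -⟩ := hr.success h
  have : IsTrans X (Linked hC.finpartition r.2) := htrans
  exact mergeCells_isControlCongruence hS (P := hC.finpartition) hC hext

theorem localize_ensures (hS : S.Valid) (hC : IsControlCongruence G S Sc C)
    (ord : LoopOrder X Ev) (hnum : ∀ i, num i ∈ S.states) :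
    Ensures (fun f => localize ord G S Sc num f C) fun r k => IsControlCongruence G S Sc r ∧
      k ≤ N * (1 + N * (3 + (4 * S.events.card + 2) * S.states.card ^ 2 + S.events.card +
        S.states.card ^ 2)) := by
  refine (Ensures.foldlM (Inv := fun _ C => IsControlCongruence G S Sc C)
    (fun i _ C hC => .charge ?_) _ C hC).mono fun r k hr => by rwa [List.length_finRange] at hr
  split_ifs
  · exact .pure ⟨hC, Nat.le_add_right _ _⟩
  refine (Ensures.foldlM (Inv := fun _ C => IsControlCongruence G S Sc C)
    (fun j _ C hC => .charge ?_) _ C hC).mono fun r k ⟨hr, hk⟩ => ⟨hr, Nat.add_le_add_left (hk.trans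
      (Nat.mul_le_mul_right _ ((List.length_filter_le _ _).trans List.length_finRange.le))) 1⟩
  split_ifs
  · exact .pure ⟨hC, by omega⟩
  refine .charge (.bind (checkMerge_ensures hS hC ord (hnum i) (hnum j)) fun r k ⟨hr, hk⟩ => ?_)
  split_ifs with h
  · exact .charge (.pure ⟨hr h, by omega⟩)
  · exact .pure ⟨hC, by omega⟩

end Localize

/-! ### `isolate` -/

section Isolate

variable {Q X Ev : Type}

/-- The partition of a disjoint union `s ∪ t` formed by partitions of `s` and of `t`. -/
noncomputable def disjUnionPartition {s t : Finset X} (P : Finpartition s) (R : Finpartition t)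
    (h : Disjoint s t) : Finpartition (s ∪ t) where
  parts := P.parts ∪ R.parts
  supIndep := by
    rw [Finset.supIndep_iff_pairwiseDisjoint, Finset.coe_union]
    exact P.disjoint.union R.disjoint fun π hπ ρ hρ _ => h.mono (P.le hπ) (R.le hρ)
  sup_parts := by rw [Finset.sup_union, P.sup_parts, R.sup_parts, Finset.sup_eq_union]
  bot_notMem h := (Finset.mem_union.1 h).elim P.bot_notMem R.bot_notMem

/-- The states that form a cell of their own. Each isolation adds one, which bounds the number of
rounds. -/
noncomputable def isolatedStates (s : Finset X) (C : Finset (Finset X)) : Finset X :=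
  s.filter fun x => {x} ∈ C

/-- `C` is a partition of `s` in which every state outside `old` is isolated. -/
def IsIsolating (old s : Finset X) (C : Finset (Finset X)) : Prop :=
  (∃ P : Finpartition s, P.parts = C) ∧ s \ old ⊆ isolatedStates s C

/-- The cover after the isolation of `x` from its cell. -/
noncomputable def splitOff (C : Finset (Finset X)) (x : X) : Finset (Finset X) :=
  (C \ {cell C x}) ∪ {cell C x \ {x}} ∪ {{x}}

variable {old s : Finset X} {C : Finset (Finset X)} {x : X}

theorem isIsolating_isolateInit (P : Finpartition old) (new : Finset X) :
    IsIsolating old new (isolateInit P.parts old new) := by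
  have hdisj : Disjoint (old \ (old \ new)) (new \ old) :=
    Finset.disjoint_sdiff.mono_left Finset.sdiff_subset
  have hunion : old \ (old \ new) ∪ (new \ old) = new := by
    rw [sdiff_sdiff_right_self, Finset.inf_eq_inter, Finset.inter_comm,
      Finset.union_comm, Finset.sdiff_union_inter]
  have hparts : ((disjUnionPartition (P.avoid (old \ new)) ⊥ hdisj).copy hunion).parts =
      isolateInit P.parts old new := by
    ext π
    simp [disjUnionPartition, isolateInit, Finpartition.avoid, Finpartition.ofErase]
  refine ⟨⟨_, hparts⟩, fun x hx => ?_⟩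
  exact Finset.mem_filter.2 ⟨Finset.sdiff_subset hx,
    Finset.mem_union_right _ (Finset.mem_image_of_mem _ hx)⟩

theorem exists_finpartition_splitOff (P : Finpartition s) (hx : x ∈ s) (hne : P.part x ≠ {x}) :
    ∃ R : Finpartition s, R.parts = splitOff P.parts x := by
  have hcut : ∀ ρ ∈ P.parts, ρ ≠ P.part x → ρ \ {x} = ρ := fun ρ hρ h =>
    Finset.sdiff_eq_self_of_disjoint <| Finset.disjoint_singleton_right.2 fun hxρ =>
      h (P.part_eq_of_mem hρ hxρ).symm
  have hrest : (P.part x \ {x}).Nonempty := by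
    rw [Finset.sdiff_nonempty, Finset.subset_singleton_iff']
    exact fun h => hne (Finset.eq_singleton_iff_unique_mem.2 ⟨P.mem_part hx, h⟩)
  have havoid : (P.avoid {x}).parts = P.parts \ {P.part x} ∪ {P.part x \ {x}} := by
    ext π
    simp only [Finpartition.avoid, Finpartition.ofErase, Finset.mem_erase, Finset.mem_image,
      Finset.mem_union, Finset.mem_sdiff, Finset.mem_singleton]
    constructor
    · rintro ⟨-, ρ, hρ, rfl⟩
      by_cases h : ρ = P.part x
      · exact Or.inr (h ▸ rfl)
      · rw [hcut ρ hρ h]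
        exact Or.inl ⟨hρ, h⟩
    · rintro (⟨hπ, h⟩ | rfl)
      · exact ⟨P.ne_bot hπ, π, hπ, hcut π hπ h⟩
      · exact ⟨hrest.ne_empty, _, P.part_mem.2 hx, rfl⟩
  refine ⟨(disjUnionPartition (P.avoid {x}) (⊥ : Finpartition {x}) Finset.sdiff_disjoint).copy
    (Finset.sdiff_union_of_subset (Finset.singleton_subset_iff.2 hx)), ?_⟩
  rw [splitOff, cell_parts, ← havoid]
  rfl

theorem IsIsolating.splitOff_and_card_lt (h : IsIsolating old s C) (hx : x ∈ s)
    (hne : cell C x ≠ {x}) :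
    IsIsolating old s (splitOff C x) ∧
      (isolatedStates s C).card < (isolatedStates s (splitOff C x)).card := by
  obtain ⟨⟨P, rfl⟩, hiso⟩ := h
  rw [cell_parts] at hne
  have hmono : isolatedStates s P.parts ⊆ isolatedStates s (splitOff P.parts x) := by
    refine Finset.monotone_filter_right _ fun y _ hy => ?_
    rw [splitOff, cell_parts]
    by_cases h : {y} = P.part x
    · obtain rfl := Finset.mem_singleton.1 (h ▸ P.mem_part hx)
      exact absurd h.symm hne
    · simp [hy, h]
  refine ⟨⟨exists_finpartition_splitOff P hx hne, hiso.trans hmono⟩,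
    Finset.card_lt_card (Finset.ssubset_iff_of_subset hmono |>.2 ⟨x, ?_, ?_⟩)⟩
  · exact Finset.mem_filter.2 ⟨hx, Finset.mem_union_right _ (Finset.mem_singleton_self _)⟩
  · exact fun h => hne (P.part_eq_of_mem (Finset.mem_filter.1 h).2 (Finset.mem_singleton_self x))

variable {G : Automaton Q Ev} {S : Automaton X Ev} {Sc : Finset Ev}

theorem Conflict.cell_ne_singleton (h : Conflict G S Sc C x) : cell C x ≠ {x} := by
  intro e
  obtain ⟨x', hx', h⟩ := h
  obtain rfl := Finset.mem_singleton.1 (e ▸ hx')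
  rcases h with h | ⟨σ, y, y', hy, hy', hn⟩
  · exact h (consistent_self _)
  · exact hn (congrArg _ (Option.some.inj (hy.symm.trans hy')))

theorem IsIsolating.isControlCongruence (hS : S.Valid) (h : IsIsolating old S.states C)
    (hc : ∀ x ∈ S.states ∩ old, ¬ Conflict G S Sc C x) : IsControlCongruence G S Sc C := by
  obtain ⟨⟨P, rfl⟩, hiso⟩ := h
  refine (isControlCongruence_parts_iff hS).2 fun x x' hx' => ?_
  have hx := P.part_nonempty.1 ⟨x', hx'⟩
  have hconf : ¬ Conflict G S Sc P.parts x := by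
    by_cases hxo : x ∈ old
    · exact hc x (Finset.mem_inter.2 ⟨hx, hxo⟩)
    · intro h
      have hsing := (Finset.mem_filter.1 (hiso (Finset.mem_sdiff.2 ⟨hx, hxo⟩))).2
      exact h.cell_ne_singleton (cell_parts P x ▸ P.part_eq_of_mem hsing
        (Finset.mem_singleton_self x))
  simp only [Conflict, cell_parts, not_exists, not_and, not_or, not_not, ne_eq] at hconf
  exact hconf x' hx'

theorem singletonCover_isControlCongruence (hS : S.Valid) :
    IsControlCongruence G S Sc (singletonCover S) := by
  refine IsIsolating.isControlCongruence (old := ∅) hS ⟨⟨⊥, ?_⟩, ?_⟩ (by simp)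
  · ext π
    simp [singletonCover]
  · exact fun x hx => Finset.mem_filter.2 ⟨Finset.sdiff_subset hx,
      Finset.mem_image_of_mem _ (Finset.sdiff_subset hx)⟩

theorem length_states_le (ord : LoopOrder X Ev) {s t : Finset X} (h : s ⊆ t) :
    (ord.states s).length ≤ t.card := by
  rw [← List.toFinset_card_of_nodup (ord.states_nodup s)]
  exact Finset.card_le_card fun x hx => h ((ord.mem_states s x).1 (List.mem_toFinset.1 hx))

theorem isolateRound_ensures (hS : S.Valid) (ord : LoopOrder X Ev)
    (h : IsIsolating old S.states C) :
    Ensures (fun _ => isolateRound ord G S Sc old C) fun r k =>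
      IsIsolating old S.states r.1 ∧
      (r.2 = true ∧ (isolatedStates S.states C).card < (isolatedStates S.states r.1).card ∨
        r.2 = false ∧ IsControlCongruence G S Sc r.1) ∧
      k ≤ S.states.card * (2 + S.states.card * (1 + S.events.card)) := by
  refine (Ensures.foldlM (Inv := fun l acc => IsIsolating old S.states acc.1 ∧
      (∀ x ∈ l, x ∈ S.states) ∧
      (acc.2 = true ∧ (isolatedStates S.states C).card < (isolatedStates S.states acc.1).card ∨
        acc.2 = false ∧ acc.1 = C ∧
          ∀ x ∈ S.states ∩ old, Conflict G S Sc C x → x ∈ l))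
    (c := 2 + S.states.card * (1 + S.events.card)) ?_ _ (C, false)
    ⟨h, fun x hx => (Finset.mem_inter.1 ((ord.mem_states _ _).1 hx)).1, Or.inr ⟨rfl, rfl,
      fun x hx _ => (ord.mem_states _ _).2 hx⟩⟩).mono fun r k ⟨⟨hr, _, hr'⟩, hk⟩ => ⟨hr, ?_, ?_⟩
  · rintro x l acc ⟨hacc, hl, hcases⟩
    have hcell : (cell acc.1 x).card * (1 + S.events.card) ≤
        S.states.card * (1 + S.events.card) := by
      obtain ⟨P, hP⟩ := hacc.1
      rw [← hP, cell_parts]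
      exact Nat.mul_le_mul_right _ (Finset.card_le_card (P.part_subset x))
    refine .charge ?_
    split_ifs with hx
    · obtain ⟨hsplit, hlt⟩ :=
        hacc.splitOff_and_card_lt (hl x List.mem_cons_self) hx.cell_ne_singleton
      refine .charge (.pure ⟨⟨hsplit, fun y hy => hl y (List.mem_cons_of_mem _ hy),
        Or.inl ⟨rfl, ?_⟩⟩, by omega⟩)
      rcases hcases with ⟨-, h⟩ | ⟨-, rfl, -⟩
      · exact h.trans hlt
      · exact hlt
    · refine .pure ⟨⟨hacc, fun y hy => hl y (List.mem_cons_of_mem _ hy), hcases.imp_right ?_⟩,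
        by omega⟩
      rintro ⟨hfalse, rfl, hrest⟩
      exact ⟨hfalse, rfl, fun y hy hconf => (List.mem_cons.1 (hrest y hy hconf)).resolve_left
        fun e => hx (e ▸ hconf)⟩
  · refine hr'.imp_right fun ⟨hfalse, hC, hrest⟩ => ⟨hfalse, hr.isControlCongruence hS ?_⟩
    exact fun x hx hconf => List.not_mem_nil (hrest x hx (hC ▸ hconf))
  · exact hk.trans (Nat.mul_le_mul_right _ (length_states_le ord Finset.inter_subset_left))

theorem isolateLoop_ensures (hS : S.Valid) (ord : LoopOrder X Ev)
    (hC : IsIsolating old S.states C) :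
    Ensures (fun f => isolateLoop ord G S Sc old f C) fun r k => IsControlCongruence G S Sc r ∧
      k ≤ (S.states.card - (isolatedStates S.states C).card + 1) *
        (1 + S.states.card * (2 + S.states.card * (1 + S.events.card))) := by
  induction hd : S.states.card - (isolatedStates S.states C).card using Nat.strong_induction_on
    generalizing C with | _ d ih
  refine .of_succ (.charge (.bind (isolateRound_ensures hS ord hC) ?_))
  rintro ⟨C', _⟩ k ⟨hC', ⟨rfl, hlt⟩ | ⟨rfl, hcongr⟩, hk⟩
  · have hle : (isolatedStates S.states C').card ≤ S.states.card := Finset.card_filter_le _ _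
    have hdecr : S.states.card - (isolatedStates S.states C').card < d :=
      hd ▸ Nat.sub_lt_sub_left (hlt.trans_le hle) hlt
    refine (ih _ hdecr hC' rfl).mono fun r k' ⟨hr, hk'⟩ => ⟨hr, ?_⟩
    have := hk'.trans (Nat.mul_le_mul_right _ hdecr)
    rw [Nat.succ_mul]
    omega
  · exact .pure ⟨hcongr, by rw [Nat.succ_mul]; omega⟩

theorem isolate_ensures (hS : S.Valid) (ord : LoopOrder X Ev) (P : Finpartition old) :
    Ensures (fun f => isolate ord G S Sc old f P.parts) fun r k => IsControlCongruence G S Sc r ∧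
      k ≤ S.states.card + (S.states.card + 1) *
        (1 + S.states.card * (2 + S.states.card * (1 + S.events.card))) :=
  .charge ((isolateLoop_ensures hS ord (isIsolating_isolateInit P _)).mono fun _ _ ⟨hr, hk⟩ =>
    ⟨hr, Nat.add_le_add_left (hk.trans (Nat.mul_le_mul_right _
      (Nat.add_le_add_right (Nat.sub_le _ _) 1))) _⟩)

end Isolate

/-! ### Control equivalence -/

section Equivalence

variable {Q X Ev : Type*}

theorem Automaton.run_append_singleton (A : Automaton X Ev) (s : List Ev) (σ : Ev) :
    A.run (s ++ [σ]) = (A.run s).bind fun x => A.trans x σ := by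
  simp [Automaton.run, List.foldlM_append]

theorem Automaton.mem_lang_of_append {A : Automaton X Ev} {s : List Ev} {σ : Ev}
    (h : s ++ [σ] ∈ A.lang) : s ∈ A.lang := by
  obtain ⟨x, hx⟩ := h
  rw [A.run_append_singleton] at hx
  obtain ⟨y, hy, -⟩ := Option.bind_eq_some_iff.1 hx
  exact ⟨y, hy⟩

theorem Automaton.markedLang_subset_lang (A : Automaton X Ev) : A.markedLang ⊆ A.lang :=
  fun _ ⟨x, _, hx⟩ => ⟨x, hx⟩

variable {G : Automaton Q Ev} {S : Automaton X Ev} {Sc : Finset Ev} {C : Finset (Finset X)}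

theorem localSupervisor_run (hS : S.Valid) (hC : IsControlCongruence G S Sc C) (s : List Ev) :
    ∀ x, S.run s = some x → (localSupervisor S C).run s = some (cell C x) := by
  induction s using List.reverseRecOn with
  | nil =>
    intro x hx
    obtain rfl : S.init = x := by simpa [Automaton.run] using hx
    rfl
  | append_singleton s σ ih =>
    intro x hx
    rw [S.run_append_singleton] at hx
    obtain ⟨y, hy, hyx⟩ := Option.bind_eq_some_iff.1 hx
    obtain ⟨hys, -, hxs⟩ := hS.trans_mem _ _ _ hyx
    rw [Automaton.run_append_singleton, ih y hy, Option.bind_some, localSupervisor_trans hS hC,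
      hC.cell_eq_part, hC.cell_eq_part]
    exact ⟨hC.finpartition.part_mem.2 hys, hC.finpartition.part_mem.2 hxs,
      y, Finpartition.mem_part _ hys, x, Finpartition.mem_part _ hxs, hyx⟩

theorem IsControlCongruence.consistent_of_mem_cell (hC : IsControlCongruence G S Sc C) {x x' : X}
    (h : x' ∈ cell C x) : Consistent G S Sc x x' := by
  obtain ⟨π, hπ, hx, hx'⟩ := mem_cell.1 h
  exact hC.consistent π hπ x hx x' hx'

theorem append_mem_lang_of_localSupervisor (hS : S.Valid) (hC : IsControlCongruence G S Sc C)
    {s : List Ev} {σ : Ev} (hσ : σ ∈ Sc) (hs : s ∈ S.lang) (hG : s ++ [σ] ∈ G.lang)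
    (hloc : s ++ [σ] ∈ (localSupervisor S C).lang) : s ++ [σ] ∈ S.lang := by
  obtain ⟨x, hx⟩ := hs
  obtain ⟨ρ, hρ⟩ := hloc
  rw [Automaton.run_append_singleton, localSupervisor_run hS hC s x hx, Option.bind_some,
    localSupervisor_trans hS hC] at hρ
  obtain ⟨-, -, x', hx', y, -, hy⟩ := hρ
  rw [Automaton.lang, Set.mem_ofPred_eq, S.run_append_singleton, hx, Option.bind_some]
  by_contra hn
  have henabled : σ ∈ S.enabled x' := Finset.mem_filter.2 ⟨(hS.trans_mem _ _ _ hy).2.1, y, hy⟩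
  have hdisabled : σ ∈ disabled G S Sc x :=
    Finset.mem_filter.2 ⟨hσ, Option.eq_none_iff_forall_ne_some.2 fun z hz => hn ⟨z, hz⟩, s, hx, hG⟩
  exact Finset.disjoint_left.1 (hC.consistent_of_mem_cell hx').2.1 henabled hdisabled

theorem mem_markedLang_of_localSupervisor (hS : S.Valid) (hC : IsControlCongruence G S Sc C)
    (hmark : ∀ x ∈ S.marked, PlantMarked G S x) {s : List Ev} (hs : s ∈ S.lang)
    (hG : s ∈ G.markedLang) (hloc : s ∈ (localSupervisor S C).markedLang) :
    s ∈ S.markedLang := by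
  obtain ⟨x, hx⟩ := hs
  obtain ⟨ρ, hρ, hrun⟩ := hloc
  rw [localSupervisor_run hS hC s x hx] at hrun
  cases hrun
  obtain ⟨x', hx', he⟩ := Finset.mem_image.1 hρ
  have hmem : x' ∈ cell C x := by
    rw [← he, hC.cell_eq_part]
    exact Finpartition.mem_part _ (hS.marked_subset hx')
  have hT : PlantMarked G S x := ⟨s, hx, hG⟩
  exact ⟨x, ((hC.consistent_of_mem_cell hmem).2.2 (iff_of_true hT (hmark x' hx'))).2 hx', hx⟩

variable {n : ℕ} {V : ControlledSystem Q X Ev n} {D : Fin n → Finset (Finset X)}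

theorem mem_lang_of_forall_localSupervisor (hS : V.sup.Valid) (hV : V.IsSupervised)
    (hD : ∀ k, IsControlCongruence V.plant V.sup (V.ctrl k) (D k)) {s : List Ev}
    (hG : s ∈ V.plant.lang) (hloc : ∀ k, s ∈ (localSupervisor V.sup (D k)).lang) :
    s ∈ V.sup.lang := by
  induction s using List.reverseRecOn with
  | nil => exact ⟨_, rfl⟩
  | append_singleton s σ ih =>
    have hs := ih (Automaton.mem_lang_of_append hG)
      fun k => Automaton.mem_lang_of_append (hloc k)
    by_cases h : ∃ k, σ ∈ V.ctrl k
    · obtain ⟨k, hk⟩ := h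
      exact append_mem_lang_of_localSupervisor hS (hD k) hk hs hG (hloc k)
    · exact hV.controllable s σ hs hG (not_exists.1 h)

theorem controlEquivalent_localSupervisor (hS : V.sup.Valid) (hV : V.IsSupervised) (hn : 0 < n)
    (hD : ∀ k, IsControlCongruence V.plant V.sup (V.ctrl k) (D k)) :
    ControlEquivalent V.plant V.sup fun k => localSupervisor V.sup (D k) := by
  constructor <;> ext s <;> simp only [Set.mem_inter_iff, Set.mem_iInter]
  · constructor
    · exact fun ⟨hG, hloc⟩ => ⟨mem_lang_of_forall_localSupervisor hS hV hD hG hloc, hG⟩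
    · rintro ⟨⟨x, hx⟩, hG⟩
      exact ⟨hG, fun k => ⟨_, localSupervisor_run hS (hD k) s x hx⟩⟩
  · constructor
    · rintro ⟨hG, hloc⟩
      have hs := mem_lang_of_forall_localSupervisor hS hV hD (Automaton.markedLang_subset_lang _ hG)
        fun k => Automaton.markedLang_subset_lang _ (hloc k)
      exact ⟨mem_markedLang_of_localSupervisor hS (hD ⟨0, hn⟩) hV.marking hs hG (hloc _), hG⟩
    · rintro ⟨⟨x, hxm, hx⟩, hG⟩
      exact ⟨hG, fun k => ⟨cell (D k) x, Finset.mem_image_of_mem _ hxm,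
        localSupervisor_run hS (hD k) s x hx⟩⟩

end Equivalence

/-! ### `TSL` -/

/-- Bound for the cost per agent of TSL when there are `N` state numbers, `x` states and `m`
events. -/
def agentCost (N x m : ℕ) : ℕ :=
  1 + (x + (x + 1) * (1 + x * (2 + x * (1 + m))) +
    (N * (1 + N * (3 + (4 * m + 2) * x ^ 2 + m + x ^ 2)) + x * (1 + m)))

theorem agentCost_le {x m : ℕ} (hx : 1 ≤ x) (hm : 1 ≤ m) :
    agentCost x x m ≤ 30 * (m * x ^ 4) := by
  have mul_le : ∀ a ≤ 4, x ^ a * m ≤ x ^ 4 * m := fun a ha =>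
    Nat.mul_le_mul_right m (Nat.pow_le_pow_right hx ha)
  have pow_le : ∀ a ≤ 4, x ^ a ≤ x ^ 4 * m := fun a ha =>
    (Nat.le_mul_of_pos_right _ hm).trans (mul_le a ha)
  have := mul_le 1 (by omega)
  have := mul_le 2 (by omega)
  have := mul_le 3 (by omega)
  have := pow_le 0 (by omega)
  have := pow_le 1 (by omega)
  have := pow_le 2 (by omega)
  have := pow_le 3 (by omega)
  have := pow_le 4 (by omega)
  rw [agentCost]
  ring_nf at *
  omega

theorem tsl_ensures {Q X Ev : Type} {n n' N : ℕ} (ord : LoopOrder X Ev) {num : Fin N → X}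
    {old : Finset X} (C : Fin n → Finpartition old) {V : ControlledSystem Q X Ev n'}
    (hS : V.sup.Valid) (hnum : ∀ i, num i ∈ V.sup.states) (M : Fin n' → Option (Fin n)) :
    Ensures (fun f => tsl ord num old (fun j => (C j).parts) V M f) fun r k =>
      (∀ k, IsControlCongruence V.plant V.sup (V.ctrl k) (r k).2 ∧
        (r k).1 = localSupervisor V.sup (r k).2) ∧
      k ≤ n' * agentCost N V.sup.states.card V.sup.events.card := by
  refine .forEach n' (P := fun k (r : Automaton (Finset X) Ev × Finset (Finset X)) =>
    IsControlCongruence V.plant V.sup (V.ctrl k) r.2 ∧ r.1 = localSupervisor V.sup r.2)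
    fun k => .charge ?_
  have localize_cover : ∀ Cinit c, (IsControlCongruence V.plant V.sup (V.ctrl k) Cinit ∧
      c ≤ V.sup.states.card + (V.sup.states.card + 1) *
        (1 + V.sup.states.card * (2 + V.sup.states.card * (1 + V.sup.events.card)))) →
      Ensures (fun f => do
        let Ck ← localize ord V.plant V.sup (V.ctrl k) num f Cinit
        charge (V.sup.states.card * (1 + V.sup.events.card))
        pure (localSupervisor V.sup Ck, Ck)) fun r c' =>
      (IsControlCongruence V.plant V.sup (V.ctrl k) r.2 ∧ r.1 = localSupervisor V.sup r.2) ∧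
        1 + (c + c') ≤ agentCost N V.sup.states.card V.sup.events.card := by
    intro Cinit c ⟨hCinit, hc⟩
    refine .bind (localize_ensures hS hCinit ord hnum) fun Ck c' ⟨hCk, hc'⟩ =>
      .charge (.pure ⟨⟨hCk, rfl⟩, ?_⟩)
    rw [agentCost]
    omega
  rcases M k with _ | j
  · exact .charge (localize_cover _ _
      ⟨singletonCover_isControlCongruence hS, Nat.le_add_right _ _⟩)
  · exact .bind (isolate_ensures hS ord (C j)) localize_cover

end SupLoc

theorem theorem2_general {Q X Ev : Type} {n n' : ℕ} {old : Finset X}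
    (C : Fin n → Finpartition old) (V : SupLoc.ControlledSystem Q X Ev n') (hS : V.sup.Valid)
    (hV : V.IsSupervised) (hn' : 0 < n') (M : Fin n' → Option (Fin n))
    (num : Fin V.sup.states.card → V.sup.states) (ord : SupLoc.LoopOrder X Ev) :
    ∃ (out : Fin n' → SupLoc.Automaton (Finset X) Ev × Finset (Finset X)) (cost : ℕ),
      SupLoc.HaltsWith
        (SupLoc.tsl ord (fun i => (num i : X)) old (fun j => (C j).parts) V M) out cost ∧
      (V.sup.events.Nonempty → cost ≤ 30 * (n' * V.sup.events.card * V.sup.states.card ^ 4)) ∧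
      (∀ k, SupLoc.IsControlCongruence V.plant V.sup (V.ctrl k) (out k).2 ∧
        (out k).1 = SupLoc.localSupervisor V.sup (out k).2) ∧
      SupLoc.ControlEquivalent V.plant V.sup (fun k => (out k).1) := by
  obtain ⟨out, cost, hrun, hout, hcost⟩ :=
    (SupLoc.tsl_ensures ord C hS (fun i => (num i).2) M).exists_haltsWith
  refine ⟨out, cost, hrun, fun hevents => hcost.trans ?_, hout, ?_⟩
  · calc n' * SupLoc.agentCost _ V.sup.states.card V.sup.events.card
        ≤ n' * (30 * (V.sup.events.card * V.sup.states.card ^ 4)) :=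
          Nat.mul_le_mul_left _ (SupLoc.agentCost_le (Finset.card_pos.2 ⟨_, hS.init_mem⟩)
            hevents.card_pos)
      _ = 30 * (n' * V.sup.events.card * V.sup.states.card ^ 4) := by ring
  · simpa only [hout] using
      SupLoc.controlEquivalent_localSupervisor hS hV hn' fun k => (hout k).1

theorem theorem2 :
    ∃ c : ℕ,
      ∀ {Q Q' X Ev : Type} {n n' : ℕ}
        -- the base system and its control congruences
        (B : SupLoc.ControlledSystem Q X Ev n) (_ : B.Valid)
        (C : Fin n → Finset (Finset X))
        (_ : ∀ k, SupLoc.IsControlCongruence B.plant B.sup (B.ctrl k) (C k))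
        -- the variant system
        (V : SupLoc.ControlledSystem Q' X Ev n') (_ : V.Valid) (_ : V.IsSupervised) (_ : 0 < n')
        (M : Fin n' → Option (Fin n))
        -- the numbering of the variant states and the order of the loops over sets
        (num : Fin V.sup.states.card ≃ V.sup.states) (ord : SupLoc.LoopOrder X Ev),
        ∃ (out : Fin n' → SupLoc.Automaton (Finset X) Ev × Finset (Finset X)) (cost : ℕ),
          SupLoc.HaltsWith (SupLoc.tsl ord (fun i => (num i : X)) B.sup.states C V M) out cost ∧
          (V.sup.events.Nonempty →
            cost ≤ c * (n' * V.sup.events.card * V.sup.states.card ^ 4)) ∧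
          (∀ k, SupLoc.IsControlCongruence V.plant V.sup (V.ctrl k) (out k).2 ∧
            (out k).1 = SupLoc.localSupervisor V.sup (out k).2) ∧
          SupLoc.ControlEquivalent V.plant V.sup (fun k => (out k).1) :=
  ⟨30, fun _ _ _ hC V hV hs hn' M num ord =>
    theorem2_general (fun k => (hC k).finpartition) V hV.sup_valid hs hn' M num ord⟩
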